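/- **Setting.** A plabic graph here is a finite planar directed graph $\mathcal G$ in a closed disc such that: it has $n$ boundary vertices $b_1,\dots,b_n$, labelled clockwise on the boundary of the disc, each of degree $1$ (a source if its edge is outgoing, a sink if its edge is incoming); every internal vertex has degree $2$ or $3$ and is coloured white or black, a white vertex having exactly one incoming edge and a black vertex exactly one outgoing edge; every connected component contains a boundary vertex. The number of boundary sources is denoted $k$ (so $\mathcal G$ is of type $(k,n)$). $\mathcal G$ is a *PBDTP graph* if every edge lies on a directed path from the boundary to the boundary. We take the disc to be the upper half-plane (with the point at infinity on its boundary), with $b_1,\dots,b_n$ on the real line, and all edges drawn as straight segments with relative interiors in the open half-plane, distinct edges meeting only in common end vertices. A *face* is a connected component $\Omega$ of the open half-plane minus the graph; the *infinite face* is the unbounded one (the one adjacent to the boundary segment going clockwise from $b_n$ to $b_1$), all others are *finite*. A *gauge ray direction* is a vector $\mathfrak l$ such that rays in direction $\mathfrak l$ from the boundary vertices point into the half-plane and pass through no internal vertex, and no edge is parallel to $\mathfrak l$. For plane vectors let $s(a,b)\in\{1,0,-1\}$ be the sign of $\det(a,b)$. For oriented edges $e,f$ (identified with their direction vectors) let $\mathrm{wind}(e,f)=\pm1$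 if $s(e,f)=s(e,\mathfrak l)=s(\mathfrak l,f)=\pm1$, and $0$ otherwise. Let $\mathrm{int}(e)$ be $s(\mathfrak l,e)$ times the number of intersections of $e$ with the rays in direction $\mathfrak l$ starting at the boundary sources (starting points of the rays not counted). An *edge signature* is a function $\epsilon$ from the edges to $\mathbb Z/2$. Two signatures are *equivalent* if they differ by a gauge transformation $\epsilon'_e=\epsilon_e+\eta(U)+\eta(V)$ for $e=(U,V)$, where $\eta$ takes values in $\mathbb Z/2$ and is $0$ at boundary vertices. A signature is *geometric* if it is equivalent to the following one. For an edge $e=(U,V)$ directed from $U$ to $V$, let $e'$ be the edge incoming at $U$ if $U$ is an internal white vertex, and let $e''$ be the edge outgoing at $V$ if $V$ is an internal black vertex; then $$\epsilon_e=\mathrm{int}(e)+\alpha(e)+\beta(e) \pmod 2,$$ $$\alpha(e)=\begin{cases}1 & U \text{ is a boundary source}\\ 1+\mathrm{wind}(e',e) & U\text{ is white}\\ 0 & U\text{ is black}\end{cases}\qquad \beta(e)=\begin{cases}0 & V \text{ is a boundary sink}\\ 0 & V\text{ is white}\\ \mathrm{wind}(e,e'') & V\text{ is black.}\end{cases}$$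 **Theorem (the total signature of a face).** Let $\mathcal G$ be a PBDTP graph of type $(k,n)$, drawn and oriented as above, let $\mathfrak l$ be a gauge ray direction and let $\epsilon$ be a geometric signature. For a face $\Omega$ let $\epsilon(\Omega)=\sum_{e\subset\partial\Omega}\epsilon_e$ be the sum over the edges bounding $\Omega$, and let $n_{\mathrm{white}}(\Omega)$ be the number of white vertices on $\partial\Omega$. Then $$\epsilon(\Omega)\equiv\begin{cases} n_{\mathrm{white}}(\Omega)+1 \pmod 2 & \text{if }\Omega\text{ is a finite face},\\ n_{\mathrm{white}}(\Omega)+k \pmod 2 & \text{if }\Omega\text{ is the infinite face.}\end{cases}$$ -/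

import Mathlib

open scoped BigOperators

noncomputable section

/-- The two colours of the internal vertices. -/
inductive PlabicColour : Type
  | white : PlabicColour
  | black : PlabicColour

/-- A planar bicoloured directed trivalent perfect graph in the disc, with `n` boundary vertices
`b_1, …, b_n` (the elements `Sum.inl i`), internal vertices `W` (the elements `Sum.inr w`) and
oriented edges `E`.  The disc is modelled by the upper half-plane (its boundary circle being the
real line together with the point at infinity), the boundary vertices lie on the real line, and
all edges are straight segments. -/
structure PlabicGraph (n : ℕ) (W E : Type*) [Fintype W] [Fintype E] where
  /-- initial vertex of an edge -/
  src : E → Fin n ⊕ W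
  /-- final vertex of an edge -/
  tgt : E → Fin n ⊕ W
  /-- colour of an internal vertex -/
  colour : W → PlabicColour
  /-- position of a vertex in the plane -/
  pos : Fin n ⊕ W → ℂ
  pos_injective : Function.Injective pos
  boundary_im : ∀ i : Fin n, (pos (Sum.inl i)).im = 0
  /-- Clockwise labelling: along the boundary of the upper half-plane, the finite boundary interval
  is traversed from right to left. -/
  boundary_clockwise : StrictAnti fun i : Fin n => (pos (Sum.inl i)).re
  internal_im : ∀ w : W, 0 < (pos (Sum.inr w)).im
  /-- no loops -/
  src_ne_tgt : ∀ e, src e ≠ tgt e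
  /-- the relative interior of each edge lies strictly inside the disc -/
  edge_inside : ∀ e, ∀ z ∈ openSegment ℝ (pos (src e)) (pos (tgt e)), 0 < z.im
  /-- an edge passes through no vertex other than its two ends -/
  vertex_on_edge : ∀ e v, pos v ∈ segment ℝ (pos (src e)) (pos (tgt e)) → v = src e ∨ v = tgt e
  /-- two distinct edges meet only in common ends -/
  edges_meet : ∀ e f, e ≠ f →
    ∀ z ∈ segment ℝ (pos (src e)) (pos (tgt e)) ∩ segment ℝ (pos (src f)) (pos (tgt f)),
      ∃ v, (v = src e ∨ v = tgt e) ∧ (v = src f ∨ v = tgt f) ∧ z = pos v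
  /-- every vertex is joined to the boundary by an undirected path -/
  connected : ∀ v, ∃ i : Fin n,
    Relation.ReflTransGen
      (fun u u' => ∃ e, (src e = u ∧ tgt e = u') ∨ (src e = u' ∧ tgt e = u)) v (Sum.inl i)
  /-- boundary vertices are univalent -/
  boundary_degree : ∀ i : Fin n, ∃! e, src e = Sum.inl i ∨ tgt e = Sum.inl i
  /-- internal vertices are bivalent or trivalent -/
  internal_degree : ∀ w : W,
    {e | src e = Sum.inr w ∨ tgt e = Sum.inr w}.ncard = 2 ∨
      {e | src e = Sum.inr w ∨ tgt e = Sum.inr w}.ncard = 3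
  /-- a white vertex has exactly one incoming edge -/
  white_perfect : ∀ w : W, colour w = PlabicColour.white → {e | tgt e = Sum.inr w}.ncard = 1
  /-- a black vertex has exactly one outgoing edge -/
  black_perfect : ∀ w : W, colour w = PlabicColour.black → {e | src e = Sum.inr w}.ncard = 1

/-- The determinant of an ordered pair of plane vectors. -/
def planeDet (a b : ℂ) : ℝ := a.re * b.im - a.im * b.re

/-- `s(a, b)`: `1`, `0` or `-1` according as the ordered pair is positively oriented, parallel, or
negatively oriented. -/
def orientIndex (a b : ℂ) : ℤ := (SignType.sign (planeDet a b) : ℤ)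

/-- The winding number of an ordered pair of edge directions with respect to the gauge ray
direction `l`. -/
def localWind (l a b : ℂ) : ℤ :=
  if orientIndex a b = 1 ∧ orientIndex a l = 1 ∧ orientIndex l b = 1 then 1
  else if orientIndex a b = -1 ∧ orientIndex a l = -1 ∧ orientIndex l b = -1 then -1
  else 0

namespace PlabicGraph

variable {n : ℕ} {W E : Type*} [Fintype W] [Fintype E] (G : PlabicGraph n W E)

/-- The closed segment that draws the edge `e`. -/
def edgeSeg (e : E) : Set ℂ := segment ℝ (G.pos (G.src e)) (G.pos (G.tgt e))

/-- The direction vector of the oriented edge `e`. -/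
def dir (e : E) : ℂ := G.pos (G.tgt e) - G.pos (G.src e)

/-- The boundary vertex `b_i` is a source: its edge is outgoing. -/
def IsSource (i : Fin n) : Prop := ∃ e, G.src e = Sum.inl i

/-- The number `k` of boundary sources, so that the graph is of type `(k, n)`. -/
def numSources : ℕ := {i : Fin n | G.IsSource i}.ncard

/-- `f` continues `e` in a directed path. -/
def Follows (e f : E) : Prop := G.tgt e = G.src f

/-- PBDTP graph: every edge lies on a directed path from the boundary to the boundary. -/
def IsPBDTP : Prop :=
  ∀ e, ∃ e₀ e₁, (∃ i : Fin n, G.src e₀ = Sum.inl i) ∧ (∃ j : Fin n, G.tgt e₁ = Sum.inl j) ∧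
    Relation.ReflTransGen G.Follows e₀ e ∧ Relation.ReflTransGen G.Follows e e₁

/-- The gauge ray starting at the boundary vertex `b_i`, without its starting point. -/
def gaugeRay (l : ℂ) (i : Fin n) : Set ℂ :=
  {z | ∃ t : ℝ, 0 < t ∧ z = G.pos (Sum.inl i) + (t : ℂ) * l}

/-- Gauge ray directions: the rays starting at boundary vertices point inside the disc, no edge is
parallel to the direction, and the rays starting at boundary vertices cross no internal vertex. -/
structure IsGaugeDirection (l : ℂ) : Prop where
  inward : 0 < l.im
  not_parallel : ∀ e, planeDet l (G.dir e) ≠ 0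
  avoids : ∀ (i : Fin n) (w : W), G.pos (Sum.inr w) ∉ G.gaugeRay l i

/-- The intersection number of the edge `e`: the number of intersections of `e` with the gauge rays
starting at the boundary sources, times `s(l, e)`.  An edge that is not parallel to `l` meets each
ray at most once, so intersections are counted by sources; the starting point of a ray does not
count. -/
def intNumber (l : ℂ) (e : E) : ℤ :=
  ({i : Fin n | G.IsSource i ∧ (G.gaugeRay l i ∩ G.edgeSeg e).Nonempty}.ncard : ℤ) *
    orientIndex l (G.dir e)

open Classical in
/-- `wind(e₁, e)` for the edge `e₁` incoming at the initial vertex of `e` (used only when that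
vertex is white, where `e₁` is unique and the sum has one term). -/
def windIn (l : ℂ) (e : E) : ℤ :=
  ∑ f : E with G.tgt f = G.src e, localWind l (G.dir f) (G.dir e)

open Classical in
/-- `wind(e, e₅)` for the edge `e₅` outgoing at the final vertex of `e` (used only when that
vertex is black, where `e₅` is unique and the sum has one term). -/
def windOut (l : ℂ) (e : E) : ℤ :=
  ∑ f : E with G.src f = G.tgt e, localWind l (G.dir e) (G.dir f)

/-- The integer whose class mod 2 is the value at `e` of the reference geometric signature. The
last case, an edge joining two boundary vertices, never occurs. -/
def geomIndex (l : ℂ) (e : E) : ℤ :=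
  match G.src e, G.tgt e with
  | Sum.inr U, Sum.inl _ =>
    match G.colour U with
    | .black => G.intNumber l e
    | .white => 1 + G.intNumber l e + G.windIn l e
  | Sum.inl _, Sum.inr V =>
    match G.colour V with
    | .black => 1 + G.intNumber l e + G.windOut l e
    | .white => 1 + G.intNumber l e
  | Sum.inr U, Sum.inr V =>
    match G.colour U, G.colour V with
    | .black, .white => G.intNumber l e
    | .white, .white => 1 + G.intNumber l e + G.windIn l e
    | .white, .black => 1 + G.intNumber l e + G.windIn l e + G.windOut l e
    | .black, .black => G.intNumber l e + G.windOut l e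
  | Sum.inl _, Sum.inl _ => 0

/-- Equivalence of edge signatures (with values `0, 1` mod 2): they differ by a gauge
transformation `η` at the internal vertices. -/
def SignatureEquiv (ε₁ ε₂ : E → ZMod 2) : Prop :=
  ∃ η : W → ZMod 2, ∀ e,
    ε₂ e = ε₁ e + Sum.elim (fun _ => 0) η (G.src e) + Sum.elim (fun _ => 0) η (G.tgt e)

/-- `ε` is a geometric signature of `G` for the gauge ray direction `l`. -/
def IsGeometricSignature (l : ℂ) (ε : E → ZMod 2) : Prop :=
  G.SignatureEquiv (fun e => (G.geomIndex l e : ZMod 2)) ε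

/-- The interior of the disc with the graph removed. -/
def graphComplement : Set ℂ := {z | 0 < z.im} \ ⋃ e, G.edgeSeg e

/-- Faces: connected components of the interior of the disc with the graph removed. -/
def IsFace (Ω : Set ℂ) : Prop :=
  ∃ z ∈ G.graphComplement, Ω = connectedComponentIn G.graphComplement z

/-- The infinite face is the one reaching the point at infinity, which lies on the boundary segment
from `b_n` clockwise to `b_1`; all other faces are finite. -/
def IsInfiniteFace (Ω : Set ℂ) : Prop := G.IsFace Ω ∧ ¬ Bornology.IsBounded Ω

/-- A finite face. -/
def IsFiniteFace (Ω : Set ℂ) : Prop := G.IsFace Ω ∧ Bornology.IsBounded Ω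

open Classical in
/-- The total signature `ε(Ω)`: the sum mod 2 over the edges bounding `Ω`. -/
def faceSignature (ε : E → ZMod 2) (Ω : Set ℂ) : ZMod 2 :=
  ∑ e : E with G.edgeSeg e ⊆ frontier Ω, ε e

/-- The number of white vertices on the boundary of `Ω`. -/
def nWhite (Ω : Set ℂ) : ℕ :=
  {w : W | G.colour w = PlabicColour.white ∧ G.pos (Sum.inr w) ∈ frontier Ω}.ncard

end PlabicGraph

end

/-!
Sheared coordinates (`absc`, and the height `im`) turn the gauge rays into vertical half-lines; no
edge is vertical. Then an edge has a face just below it and a face just above it, a vertex has a face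
above it and (if internal) one below it, and everything follows from one principle: moving vertically,
a function `f` of the faces changes by the sum of its jumps across the edges met
(`sum_jump_crossed`). Applied close to a vertex, the principle compares the faces around the vertex
(`sum_jump_side`, `sum_jump_above`, `sum_jump_below`); applied along a gauge ray, it compares the face
at its start with the infinite face (`sum_jump_ray`).

The topological input is Euler's formula for a single face `Ω`: the number of edges with `Ω` just
below them, plus one if `Ω` is infinite, exceeds by one the number of internal vertices with `Ω`
just below them (`card_belowFace_eq`). One inequality, `card_belowFace_le`, holds because `Ω` is
connected: the edge first met when going up from a point (its ceiling) changes only where the point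
crosses the vertical segment below an internal vertex. Summed over all faces it is opposite to
`card_faces_add_card_le`, which holds because every vertex is joined to the boundary: over `ℚ`, the
jumps of functions of the faces are orthogonal to the coboundaries of functions of the internal
vertices. So both are equalities, and every function of the edges is the sum of a jump function and a
coboundary. Hence an edge with the same face on both sides would by itself be a coboundary; the
corresponding function of the vertices, zero at the boundary, would be monotone along a directed path
through this edge from the boundary to the boundary and change at it, which is absurd
(`sideFace_ne`). Therefore the edges bounding `Ω` are exactly those across which the indicator of `Ω`
jumps, and an internal vertex has at most one corner in `Ω`.

Mod 2, two consecutive edges have winding `1` exactly when they leave their common vertex to the same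
side with the second one above the first one (`localWind_cast`). So the winding terms of the total
signature at a vertex are jumps across the edges above the incoming edge (white vertices) or below
the outgoing edge (black vertices). Writing `b(e)` and `d(w)` for the indicators of `Ω` just below `e`
and just below `w`, the contribution of an internal vertex `w` is `d(w)`, plus the sum of `b(e)` over
the edges leaving `w`, plus `1` if `w` is white and lies on the boundary of `Ω`
(`sum_index_internal`). The boundary vertices and the intersections with the rays contribute the
remaining `b(e)` and one indicator of the infinite face for each source, and Euler's formula for `Ω`
evaluates the sum of all `b(e)` and `d(w)`.
-/

open scoped Topology
open Filter

noncomputable section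

namespace PlabicGraph

/-! ### The coordinates adapted to the gauge ray direction -/

/-- The abscissa of a point in the oblique coordinates in which the gauge rays are the vertical
half-lines going up; the second coordinate is the height `z.im`. For `l = Complex.I` it is the
real part. -/
def absc (l z : ℂ) : ℝ := planeDet z l

/-- The point with abscissa `x` and height `y`. -/
def pointAt (l : ℂ) (x y : ℝ) : ℂ := ⟨(x + y * l.re) / l.im, y⟩

@[simp] lemma pointAt_im (l : ℂ) (x y : ℝ) : (pointAt l x y).im = y := rfl

lemma absc_pointAt {l : ℂ} (hl : 0 < l.im) (x y : ℝ) : absc l (pointAt l x y) = x := by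
  simp only [absc, planeDet, pointAt]
  field_simp
  ring

lemma pointAt_absc_im {l : ℂ} (hl : 0 < l.im) (z : ℂ) : pointAt l (absc l z) z.im = z := by
  apply Complex.ext
  · simp only [absc, planeDet, pointAt]
    field_simp
    ring
  · rfl

lemma ext_absc_im {l : ℂ} (hl : 0 < l.im) {z w : ℂ} (h₁ : absc l z = absc l w)
    (h₂ : z.im = w.im) : z = w := by
  rw [← pointAt_absc_im hl z, h₁, h₂, pointAt_absc_im hl]

lemma absc_add (l z w : ℂ) : absc l (z + w) = absc l z + absc l w := by
  simp only [absc, planeDet, Complex.add_re, Complex.add_im]; ring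

lemma absc_sub (l z w : ℂ) : absc l (z - w) = absc l z - absc l w := by
  simp only [absc, planeDet, Complex.sub_re, Complex.sub_im]; ring

lemma absc_smul (l : ℂ) (t : ℝ) (z : ℂ) : absc l (t • z) = t * absc l z := by
  simp [absc, planeDet]; ring

lemma absc_mul_self (l : ℂ) (t : ℝ) : absc l ((t : ℂ) * l) = 0 := by
  simp [absc, planeDet]; ring

@[fun_prop] lemma continuous_absc (l : ℂ) : Continuous (absc l) := by
  unfold absc planeDet; fun_prop

lemma continuous_pointAt (l : ℂ) : Continuous fun p : ℝ × ℝ => pointAt l p.1 p.2 := by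
  have : (fun p : ℝ × ℝ => pointAt l p.1 p.2) =
      fun p : ℝ × ℝ => (((p.1 + p.2 * l.re) / l.im : ℝ) : ℂ) + (p.2 : ℂ) * Complex.I := by
    funext p
    apply Complex.ext <;> simp [pointAt]
  rw [this]
  fun_prop

@[fun_prop] lemma continuous_pointAt_comp {α : Type*} [TopologicalSpace α] (l : ℂ) {f g : α → ℝ}
    (hf : Continuous f) (hg : Continuous g) : Continuous fun a => pointAt l (f a) (g a) :=
  (continuous_pointAt l).comp (hf.prodMk hg)

/-- `planeDet` in the coordinates given by abscissa and height. -/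
lemma planeDet_mul_im (l a b : ℂ) :
    planeDet a b * l.im = absc l a * b.im - a.im * absc l b := by
  simp only [absc, planeDet]; ring

/-- The sign `+1` (right, or above) or `-1` (left, or below). -/
def sg (s : Bool) : ℝ := if s then 1 else -1

@[simp] lemma sg_true : sg true = 1 := rfl
@[simp] lemma sg_false : sg false = -1 := rfl
lemma sg_mul_self (s : Bool) : sg s * sg s = 1 := by cases s <;> simp
lemma sg_ne_zero (s : Bool) : sg s ≠ 0 := by cases s <;> simp

variable {n : ℕ} {W E : Type*} [Fintype W] [Fintype E] (G : PlabicGraph n W E) (l : ℂ)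

/-- For `s = true` the left end of the edge `e`, for `s = false` its right end. Thus
`G.nend l s e = v` says that `e` leaves the vertex `v` to the right (`s = true`) or to the left
(`s = false`), whatever the orientation of `e`. -/
def nend (s : Bool) (e : E) : Fin n ⊕ W :=
  if 0 < sg s * absc l (G.dir e) then G.src e else G.tgt e

/-- The slope of the edge `e` in the oblique coordinates. It makes sense because no edge is parallel
to `l`. -/
def slope (e : E) : ℝ := (G.dir e).im / absc l (G.dir e)

/-- The abscissa of the vertex `v`. -/
abbrev vx (v : Fin n ⊕ W) : ℝ := absc l (G.pos v)

/-- The height at abscissa `x` of the line carrying the edge `e`. -/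
def ht (e : E) (x : ℝ) : ℝ := (G.pos (G.src e)).im + G.slope l e * (x - G.vx l (G.src e))

/-- The edge `e` crosses the vertical line with abscissa `x` in an inner point. -/
def Spans (e : E) (x : ℝ) : Prop :=
  G.vx l (G.nend l true e) < x ∧ x < G.vx l (G.nend l false e)

/-- The face that contains the point `z` (empty if `z` is not in the complement of the graph). -/
def faceAt (z : ℂ) : Set ℂ := connectedComponentIn G.graphComplement z

variable {G l}

lemma IsGaugeDirection.absc_dir_ne (hl : G.IsGaugeDirection l) (e : E) :
    absc l (G.dir e) ≠ 0 := by
  have := hl.not_parallel e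
  intro h
  apply this
  simp only [absc, planeDet] at h ⊢
  linarith

lemma absc_dir (e : E) : absc l (G.dir e) = G.vx l (G.tgt e) - G.vx l (G.src e) := by
  rw [dir, absc_sub]

lemma nend_cases (hl : G.IsGaugeDirection l) (e : E) :
    (0 < absc l (G.dir e) ∧ G.nend l true e = G.src e ∧ G.nend l false e = G.tgt e) ∨
      (absc l (G.dir e) < 0 ∧ G.nend l true e = G.tgt e ∧ G.nend l false e = G.src e) := by
  rcases lt_or_gt_of_ne (hl.absc_dir_ne e) with h | h
  · right
    refine ⟨h, ?_, ?_⟩ <;> simp [nend, h, h.le]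
  · left
    refine ⟨h, ?_, ?_⟩ <;> simp [nend, h, h.le]

lemma nend_lt (hl : G.IsGaugeDirection l) (e : E) :
    G.vx l (G.nend l true e) < G.vx l (G.nend l false e) := by
  have := absc_dir (G := G) (l := l) e
  rcases nend_cases hl e with ⟨h, h1, h2⟩ | ⟨h, h1, h2⟩ <;> rw [h1, h2] <;> linarith

lemma nend_eq_or (s : Bool) (e : E) : G.nend l s e = G.src e ∨ G.nend l s e = G.tgt e := by
  unfold nend; split_ifs <;> simp

lemma exists_nend_eq (hl : G.IsGaugeDirection l) {e : E} {v : Fin n ⊕ W} :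
    (v = G.src e ∨ v = G.tgt e) ↔ ∃ s, G.nend l s e = v := by
  simp only [Bool.exists_bool]
  rcases nend_cases hl e with ⟨-, h1, h2⟩ | ⟨-, h1, h2⟩ <;> rw [h1, h2] <;> tauto

lemma slope_mul (hl : G.IsGaugeDirection l) (e : E) :
    G.slope l e * (G.vx l (G.tgt e) - G.vx l (G.src e)) =
      (G.pos (G.tgt e)).im - (G.pos (G.src e)).im := by
  rw [slope, ← absc_dir, div_mul_cancel₀ _ (hl.absc_dir_ne e)]
  simp [dir]

lemma ht_nend (hl : G.IsGaugeDirection l) (s : Bool) (e : E) :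
    G.ht l e (G.vx l (G.nend l s e)) = (G.pos (G.nend l s e)).im := by
  rcases nend_eq_or (G := G) (l := l) s e with h | h <;> rw [h, ht]
  · ring
  · rw [slope_mul hl]; ring

lemma ht_eq (hl : G.IsGaugeDirection l) (s : Bool) (e : E) (x : ℝ) :
    G.ht l e x = (G.pos (G.nend l s e)).im + G.slope l e * (x - G.vx l (G.nend l s e)) := by
  rw [← ht_nend hl, ht, ht]; ring

@[fun_prop] lemma continuous_ht (e : E) : Continuous (G.ht l e) := by
  unfold ht; fun_prop

lemma edgeSeg_eq (hl : G.IsGaugeDirection l) (e : E) :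
    G.edgeSeg e = segment ℝ (G.pos (G.nend l true e)) (G.pos (G.nend l false e)) := by
  rcases nend_cases hl e with ⟨-, h1, h2⟩ | ⟨-, h1, h2⟩ <;> rw [h1, h2, edgeSeg]
  rw [segment_symm]

lemma ht_combo (e : E) (a b x y : ℝ) (h : a + b = 1) :
    G.ht l e (a * x + b * y) = a * G.ht l e x + b * G.ht l e y := by
  obtain rfl : a = 1 - b := by linarith
  unfold ht; ring

lemma mem_edgeSeg (hl : G.IsGaugeDirection l) {e : E} {z : ℂ} :
    z ∈ G.edgeSeg e ↔ (G.vx l (G.nend l true e) ≤ absc l z ∧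
      absc l z ≤ G.vx l (G.nend l false e)) ∧ z.im = G.ht l e (absc l z) := by
  have hlt := nend_lt hl e
  rw [edgeSeg_eq hl]
  constructor
  · rintro ⟨a, b, ha, hb, hab, rfl⟩
    rw [absc_add, absc_smul, absc_smul, ht_combo _ _ _ _ _ hab, ht_nend hl, ht_nend hl]
    refine ⟨⟨?_, ?_⟩, by simp⟩
    · obtain rfl : a = 1 - b := by linarith
      nlinarith
    · obtain rfl : b = 1 - a := by linarith
      nlinarith
  · rintro ⟨⟨h1, h2⟩, h3⟩
    have hd : 0 < G.vx l (G.nend l false e) - G.vx l (G.nend l true e) := by linarith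
    set d := G.vx l (G.nend l false e) - G.vx l (G.nend l true e) with hd'
    have hab : (G.vx l (G.nend l false e) - absc l z) / d +
        (absc l z - G.vx l (G.nend l true e)) / d = 1 := by
      rw [← add_div, div_eq_one_iff_eq hd.ne']; rw [hd']; ring
    have hx : absc l z = (G.vx l (G.nend l false e) - absc l z) / d * G.vx l (G.nend l true e) +
        (absc l z - G.vx l (G.nend l true e)) / d * G.vx l (G.nend l false e) := by
      field_simp
      rw [hd']; ring
    refine ⟨_, _, div_nonneg (by linarith) hd.le, div_nonneg (by linarith) hd.le, hab, ?_⟩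
    apply ext_absc_im hl.inward
    · rw [absc_add, absc_smul, absc_smul]; exact hx.symm
    · rw [h3]
      conv_rhs => rw [hx, ht_combo _ _ _ _ _ hab, ht_nend hl, ht_nend hl]
      simp

lemma pointAt_mem_edgeSeg (hl : G.IsGaugeDirection l) {e : E} {x : ℝ} (hx : G.Spans l e x) :
    pointAt l x (G.ht l e x) ∈ G.edgeSeg e := by
  rw [mem_edgeSeg hl, absc_pointAt hl.inward]
  exact ⟨⟨hx.1.le, hx.2.le⟩, rfl⟩

lemma pos_nend_mem (s : Bool) (e : E) :
    G.pos (G.nend l s e) ∈ G.edgeSeg e := by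
  rcases nend_eq_or (G := G) (l := l) s e with h | h <;> rw [h]
  · exact left_mem_segment _ _ _
  · exact right_mem_segment _ _ _

lemma ht_pos_of_spans (hl : G.IsGaugeDirection l) {e : E} {x : ℝ} (hx : G.Spans l e x) :
    0 < G.ht l e x := by
  have h := pointAt_mem_edgeSeg hl hx
  have key := G.edge_inside e (pointAt l x (G.ht l e x))
  rw [pointAt_im] at key
  apply key
  have hne : ∀ s, pointAt l x (G.ht l e x) ≠ G.pos (G.nend l s e) := by
    intro s hs
    have h1 : x = G.vx l (G.nend l s e) := by
      rw [vx, ← hs, absc_pointAt hl.inward]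
    cases s
    · exact hx.2.ne h1
    · exact hx.1.ne' h1
  apply mem_openSegment_of_ne_left_right _ _ h
  · intro h'
    obtain ⟨s, hs⟩ := (exists_nend_eq hl (e := e)).1 (Or.inl rfl)
    exact hne s (by rw [hs, h'])
  · intro h'
    obtain ⟨s, hs⟩ := (exists_nend_eq hl (e := e)).1 (Or.inr rfl)
    exact hne s (by rw [hs, h'])

lemma im_pos_nonneg (v : Fin n ⊕ W) : 0 ≤ (G.pos v).im := by
  rcases v with i | w
  · exact (G.boundary_im i).ge
  · exact (G.internal_im w).le

/-- A vertex on an edge is one of its two ends. -/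
lemma nend_of_mem_edgeSeg (hl : G.IsGaugeDirection l) {e : E} {v : Fin n ⊕ W}
    (h : G.pos v ∈ G.edgeSeg e) : ∃ s, G.nend l s e = v :=
  (exists_nend_eq hl).1 (G.vertex_on_edge e v h)

/-- An inner point of an edge lies on no other edge. -/
lemma pointAt_notMem_edgeSeg (hl : G.IsGaugeDirection l) {e f : E} (hef : f ≠ e) {x : ℝ}
    (hx : G.Spans l e x) : pointAt l x (G.ht l e x) ∉ G.edgeSeg f := by
  intro hf
  have he := pointAt_mem_edgeSeg hl hx
  obtain ⟨v, hv, -, hz⟩ := G.edges_meet e f hef.symm _ ⟨he, hf⟩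
  obtain ⟨s, rfl⟩ := (exists_nend_eq hl).1 hv
  have h1 : x = G.vx l (G.nend l s e) := by
    rw [vx, ← hz, absc_pointAt hl.inward]
  cases s
  · exact hx.2.ne h1
  · exact hx.1.ne' h1

lemma isClosed_edgeSeg (e : E) : IsClosed (G.edgeSeg e) := by
  rw [edgeSeg, segment_eq_image_lineMap]
  exact (isCompact_Icc.image AffineMap.lineMap_continuous).isClosed

lemma mem_graphComplement {z : ℂ} :
    z ∈ G.graphComplement ↔ 0 < z.im ∧ ∀ e, z ∉ G.edgeSeg e := by
  simp [graphComplement]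

lemma isOpen_graphComplement : IsOpen G.graphComplement := by
  apply IsOpen.sdiff
  · exact isOpen_lt continuous_const Complex.continuous_im
  · exact isClosed_iUnion_of_finite isClosed_edgeSeg

lemma mem_faceAt_self {z : ℂ} (hz : z ∈ G.graphComplement) : z ∈ G.faceAt z :=
  mem_connectedComponentIn hz

lemma isOpen_faceAt (z : ℂ) : IsOpen (G.faceAt z) :=
  isOpen_graphComplement.connectedComponentIn

lemma faceAt_subset (z : ℂ) : G.faceAt z ⊆ G.graphComplement := connectedComponentIn_subset _ _

lemma faceAt_eq_of_mem {z w : ℂ} (h : w ∈ G.faceAt z) : G.faceAt w = G.faceAt z :=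
  (connectedComponentIn_eq h).symm

lemma faceAt_eq_of_preconnected {S : Set ℂ} (hS : IsPreconnected S) (h : S ⊆ G.graphComplement)
    {z w : ℂ} (hz : z ∈ S) (hw : w ∈ S) : G.faceAt z = G.faceAt w :=
  (faceAt_eq_of_mem (hS.subset_connectedComponentIn hz h hw)).symm

lemma eventually_faceAt_eq {z : ℂ} (hz : z ∈ G.graphComplement) :
    ∀ᶠ w in 𝓝 z, w ∈ G.graphComplement ∧ G.faceAt w = G.faceAt z := by
  filter_upwards [(isOpen_faceAt z).mem_nhds (mem_faceAt_self hz)] with w hw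
  exact ⟨faceAt_subset z hw, faceAt_eq_of_mem hw⟩

lemma faceAt_eq_of_vertical {x y₁ y₂ : ℝ}
    (h : ∀ y ∈ Set.Icc y₁ y₂, pointAt l x y ∈ G.graphComplement) (h12 : y₁ ≤ y₂) :
    G.faceAt (pointAt l x y₁) = G.faceAt (pointAt l x y₂) := by
  apply faceAt_eq_of_preconnected (S := (pointAt l x) '' Set.Icc y₁ y₂)
  · exact isPreconnected_Icc.image _ (by fun_prop)
  · rintro _ ⟨y, hy, rfl⟩; exact h y hy
  · exact ⟨_, ⟨le_rfl, h12⟩, rfl⟩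
  · exact ⟨_, ⟨h12, le_rfl⟩, rfl⟩

/-! ### The faces on the two sides of an edge -/

lemma convex_side (e : E) (s : Bool) :
    Convex ℝ {z : ℂ | 0 < sg s * (z.im - G.ht l e (absc l z))} := by
  intro z hz w hw a b ha hb hab
  simp only [Set.mem_ofPred_eq] at *
  rw [absc_add, absc_smul, absc_smul, ht_combo _ _ _ _ _ hab]
  have : sg s * ((a • z + b • w).im - (a * G.ht l e (absc l z) + b * G.ht l e (absc l w))) =
      a * (sg s * (z.im - G.ht l e (absc l z))) + b * (sg s * (w.im - G.ht l e (absc l w))) := by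
    simp; ring
  rw [this]
  rcases ha.eq_or_lt with rfl | ha'
  · obtain rfl : b = 1 := by linarith
    simpa using hw
  · have := mul_pos ha' hz
    have := mul_nonneg hb hw.le
    linarith

lemma isOpen_spans (e : E) : IsOpen {x | G.Spans l e x} :=
  (isOpen_lt continuous_const continuous_id).inter (isOpen_lt continuous_id continuous_const)

/-- Near an inner point of an edge there is nothing else of the graph. -/
lemma eventually_near_edge (hl : G.IsGaugeDirection l) {e : E} {x : ℝ} (hx : G.Spans l e x) :
    ∀ᶠ z in 𝓝 (pointAt l x (G.ht l e x)),
      0 < z.im ∧ G.Spans l e (absc l z) ∧ ∀ f, f ≠ e → z ∉ G.edgeSeg f := by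
  refine Filter.Eventually.and ?_ (Filter.Eventually.and ?_ ?_)
  · exact (isOpen_lt continuous_const Complex.continuous_im).mem_nhds (ht_pos_of_spans hl hx)
  · apply ((isOpen_spans e).preimage (continuous_absc l)).mem_nhds
    simpa [absc_pointAt hl.inward] using hx
  · rw [Filter.eventually_all]
    intro f
    by_cases hf : f = e
    · simp [hf]
    · filter_upwards [(isClosed_edgeSeg f).isOpen_compl.mem_nhds (pointAt_notMem_edgeSeg hl hf hx)]
        with z hz _ using hz

lemma exists_side_at (hl : G.IsGaugeDirection l) (s : Bool) {e : E} {x : ℝ}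
    (hx : G.Spans l e x) :
    ∃ A, ∀ᶠ z in 𝓝 (pointAt l x (G.ht l e x)),
      0 < sg s * (z.im - G.ht l e (absc l z)) → z ∈ G.graphComplement ∧ G.faceAt z = A := by
  obtain ⟨ε, hε, hball⟩ := Metric.eventually_nhds_iff_ball.1 (eventually_near_edge hl hx)
  set S := Metric.ball (pointAt l x (G.ht l e x)) ε ∩
    {z : ℂ | 0 < sg s * (z.im - G.ht l e (absc l z))} with hS
  have hSC : S ⊆ G.graphComplement := by
    rintro z ⟨hz, hz'⟩
    obtain ⟨h1, h2, h3⟩ := hball z hz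
    refine mem_graphComplement.2 ⟨h1, fun f => ?_⟩
    by_cases hf : f = e
    · rintro hzf
      subst hf
      rw [mem_edgeSeg hl] at hzf
      simp only [Set.mem_ofPred_eq, hzf.2, sub_self, mul_zero, lt_self_iff_false] at hz'
    · exact h3 f hf
  have hpre : IsPreconnected S := ((convex_ball _ _).inter (convex_side e s)).isPreconnected
  by_cases hne : S.Nonempty
  · obtain ⟨z₀, hz₀⟩ := hne
    refine ⟨G.faceAt z₀, ?_⟩
    filter_upwards [Metric.ball_mem_nhds _ hε] with z hz hz'
    exact ⟨hSC ⟨hz, hz'⟩, faceAt_eq_of_preconnected hpre hSC ⟨hz, hz'⟩ hz₀⟩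
  · refine ⟨∅, ?_⟩
    filter_upwards [Metric.ball_mem_nhds _ hε] with z hz hz'
    exact absurd ⟨z, hz, hz'⟩ hne

lemma tendsto_pointAt_add (s : Bool) (x y : ℝ) :
    Tendsto (fun t => pointAt l x (y + sg s * t)) (𝓝[>] 0) (𝓝 (pointAt l x y)) := by
  have : Continuous fun t => pointAt l x (y + sg s * t) := by fun_prop
  have h := this.tendsto 0
  simp only [mul_zero, add_zero] at h
  exact h.mono_left nhdsWithin_le_nhds

lemma eventually_side (hl : G.IsGaugeDirection l) (s : Bool) (e : E) (x : ℝ) {P : ℂ → Prop}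
    (h : ∀ᶠ z in 𝓝 (pointAt l x (G.ht l e x)), 0 < sg s * (z.im - G.ht l e (absc l z)) → P z) :
    ∀ᶠ t in 𝓝[>] (0 : ℝ), P (pointAt l x (G.ht l e x + sg s * t)) := by
  filter_upwards [(tendsto_pointAt_add s x _).eventually h, self_mem_nhdsWithin] with t ht ht0
  apply ht
  rw [absc_pointAt hl.inward, pointAt_im, add_sub_cancel_left, ← mul_assoc, sg_mul_self, one_mul]
  exact ht0

/-- All points close to the edge and on a given side of it lie in one face, since the local face is
locally constant along the edge. -/
lemma exists_side (hl : G.IsGaugeDirection l) (s : Bool) (e : E) :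
    ∃ A, ∀ x, G.Spans l e x → ∀ᶠ z in 𝓝 (pointAt l x (G.ht l e x)),
      0 < sg s * (z.im - G.ht l e (absc l z)) → z ∈ G.graphComplement ∧ G.faceAt z = A := by
  have hch : ∀ x : ℝ, ∃ A, G.Spans l e x → ∀ᶠ z in 𝓝 (pointAt l x (G.ht l e x)),
      0 < sg s * (z.im - G.ht l e (absc l z)) → z ∈ G.graphComplement ∧ G.faceAt z = A := by
    intro x
    by_cases hx : G.Spans l e x
    · obtain ⟨A, hA⟩ := exists_side_at hl s hx
      exact ⟨A, fun _ => hA⟩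
    · exact ⟨∅, fun h => absurd h hx⟩
  choose A hA using hch
  obtain ⟨x₀, hx₀⟩ := exists_between (nend_lt hl e)
  refine ⟨A x₀, fun x hx => ?_⟩
  have hpre : IsPreconnected {x | G.Spans l e x} := isPreconnected_Ioo
  have key : A x = A x₀ := by
    refine IsPreconnected.induction₂ (s := {x | G.Spans l e x}) hpre (fun x y => A x = A y)
      (fun x hx => ?_) (fun x y z _ _ _ => Eq.trans) (fun x y _ _ => Eq.symm) hx hx₀
    have hcont : Continuous fun y => pointAt l y (G.ht l e y) := by fun_prop
    have h1 := (hcont.tendsto x).eventually (eventually_eventually_nhds.2 (hA x hx))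
    filter_upwards [mem_nhdsWithin_of_mem_nhds h1, self_mem_nhdsWithin] with y hy hy'
    obtain ⟨t, h2, h3⟩ :=
      ((eventually_side hl s e y hy).and (eventually_side hl s e y (hA y hy'))).exists
    exact h2.2.symm.trans h3.2
  rw [← key]
  exact hA x hx

open Classical in
/-- The face adjacent to the edge `e` from above (`s = true`) or from below (`s = false`). -/
def sideFace (G : PlabicGraph n W E) (l : ℂ) (s : Bool) (e : E) : Set ℂ :=
  if hl : G.IsGaugeDirection l then (exists_side hl s e).choose else ∅

lemma sideFace_spec (hl : G.IsGaugeDirection l) (s : Bool) (e : E) {x : ℝ}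
    (hx : G.Spans l e x) : ∀ᶠ z in 𝓝 (pointAt l x (G.ht l e x)),
      0 < sg s * (z.im - G.ht l e (absc l z)) →
        z ∈ G.graphComplement ∧ G.faceAt z = G.sideFace l s e := by
  rw [sideFace, dif_pos hl]
  exact (exists_side hl s e).choose_spec x hx

lemma eventually_sideFace (hl : G.IsGaugeDirection l) (s : Bool) (e : E) {x : ℝ}
    (hx : G.Spans l e x) : ∀ᶠ t in 𝓝[>] (0 : ℝ),
      pointAt l x (G.ht l e x + sg s * t) ∈ G.graphComplement ∧
        G.faceAt (pointAt l x (G.ht l e x + sg s * t)) = G.sideFace l s e :=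
  eventually_side hl s e x (sideFace_spec hl s e hx)

/-- No internal vertex lies on the vertical line with abscissa `x`. Boundary vertices are allowed:
they have height `0` and do not obstruct vertical motion in the open half-plane. -/
def IsClean (G : PlabicGraph n W E) (l : ℂ) (x : ℝ) : Prop := ∀ w : W, G.vx l (Sum.inr w) ≠ x

/-- The jump of a function `f` of the faces across the edge `e`, from below to above. -/
def jump {A : Type*} [AddCommGroup A] (G : PlabicGraph n W E) (l : ℂ) (f : Set ℂ → A) (e : E) : A :=
  f (G.sideFace l true e) - f (G.sideFace l false e)

lemma mem_graphComplement_of_clean (hl : G.IsGaugeDirection l) {x y : ℝ} (hx : G.IsClean l x)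
    (hy : 0 < y) : pointAt l x y ∈ G.graphComplement ↔
      ∀ e, G.Spans l e x → y ≠ G.ht l e x := by
  rw [mem_graphComplement, pointAt_im]
  constructor
  · rintro ⟨-, h⟩ e he rfl
    exact h e (pointAt_mem_edgeSeg hl he)
  · intro h
    refine ⟨hy, fun e he => ?_⟩
    have he' := he
    rw [mem_edgeSeg hl, absc_pointAt hl.inward, pointAt_im] at he
    have hne : ∀ s, G.vx l (G.nend l s e) ≠ x := by
      intro s hs
      have him : (G.pos (G.nend l s e)).im = y := by rw [← ht_nend hl, hs, he.2]
      rcases hv : G.nend l s e with i | w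
      · rw [hv, G.boundary_im] at him; linarith
      · rw [hv] at hs; exact hx w hs
    exact h e ⟨lt_of_le_of_ne he.1.1 (hne true), lt_of_le_of_ne he.1.2 (hne false).symm⟩ he.2

lemma ht_ne_ht (hl : G.IsGaugeDirection l) {e f : E} {x : ℝ} (he : G.Spans l e x)
    (hf : G.Spans l f x) (hef : f ≠ e) : G.ht l e x ≠ G.ht l f x := by
  intro h
  apply pointAt_notMem_edgeSeg hl hef he
  rw [h]; exact pointAt_mem_edgeSeg hl hf

/-- The edges met in inner points by the vertical segment with abscissa `x` between the heights
`y₁` and `y₂`. -/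
def crossed (G : PlabicGraph n W E) (l : ℂ) (x y₁ y₂ : ℝ) : Set E :=
  {e | G.Spans l e x ∧ y₁ < G.ht l e x ∧ G.ht l e x < y₂}

/-- Going up from a point on a vertical line free of internal vertices, either no edge is met, or the
first edge met has the starting point in the face below it. -/
lemma going_up (hl : G.IsGaugeDirection l) {x y₁ y₂ : ℝ} (hx : G.IsClean l x) (hy : 0 < y₁)
    (h1 : pointAt l x y₁ ∈ G.graphComplement) (h2 : pointAt l x y₂ ∈ G.graphComplement)
    (h12 : y₁ ≤ y₂) :
    (G.crossed l x y₁ y₂ = ∅ ∧ G.faceAt (pointAt l x y₁) = G.faceAt (pointAt l x y₂)) ∨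
      ∃ e ∈ G.crossed l x y₁ y₂, (∀ f ∈ G.crossed l x y₁ y₂, G.ht l e x ≤ G.ht l f x) ∧
        G.faceAt (pointAt l x y₁) = G.sideFace l false e := by
  have hmem : ∀ y, 0 < y → (pointAt l x y ∈ G.graphComplement ↔
      ∀ e, G.Spans l e x → y ≠ G.ht l e x) := fun y hy => mem_graphComplement_of_clean hl hx hy
  rcases (G.crossed l x y₁ y₂).eq_empty_or_nonempty with hemp | hne
  · left
    refine ⟨hemp, faceAt_eq_of_vertical (fun y hyI => ?_) h12⟩
    rw [hmem y (hy.trans_le hyI.1)]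
    rintro e he rfl
    have : e ∉ G.crossed l x y₁ y₂ := by simp [hemp]
    apply this
    refine ⟨he, lt_of_le_of_ne hyI.1 ?_, lt_of_le_of_ne hyI.2 ?_⟩
    · exact (hmem y₁ hy).1 h1 e he
    · exact ((hmem y₂ (hy.trans_le h12)).1 h2 e he).symm
  · right
    obtain ⟨e, he, hmin⟩ := Set.exists_min_image _ (fun e => G.ht l e x) (Set.toFinite _) hne
    refine ⟨e, he, hmin, ?_⟩
    have hev := (eventually_sideFace hl false e he.1).and
      (Ioo_mem_nhdsGT (show (0 : ℝ) < G.ht l e x - y₁ by linarith [he.2.1]))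
    obtain ⟨t, ⟨-, ht2⟩, ht3, ht4⟩ := hev.exists
    rw [← ht2]
    simp only [sg_false]
    refine faceAt_eq_of_vertical (fun y hyI => ?_) (by linarith)
    rw [hmem y (hy.trans_le hyI.1)]
    rintro f hf rfl
    have hf' : f ∈ G.crossed l x y₁ y₂ :=
      ⟨hf, lt_of_le_of_ne hyI.1 ((hmem y₁ hy).1 h1 f hf), by linarith [hyI.2, he.2.2]⟩
    have := hmin f hf'
    linarith [hyI.2]

open Classical in
/-- The change of a function of faces along a vertical segment is the sum of its jumps across the
edges met. -/
lemma sum_jump_crossed (hl : G.IsGaugeDirection l) {A : Type*} [AddCommGroup A] (f : Set ℂ → A)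
    {x y₁ y₂ : ℝ} (hx : G.IsClean l x) (hy : 0 < y₁)
    (h1 : pointAt l x y₁ ∈ G.graphComplement) (h2 : pointAt l x y₂ ∈ G.graphComplement)
    (h12 : y₁ ≤ y₂) :
    ∑ e with e ∈ G.crossed l x y₁ y₂, G.jump l f e =
      f (G.faceAt (pointAt l x y₂)) - f (G.faceAt (pointAt l x y₁)) := by
  induction hk : (Finset.univ.filter (· ∈ G.crossed l x y₁ y₂)).card using Nat.strong_induction_on
    generalizing y₁ with
  | _ k ih =>
  rcases going_up hl hx hy h1 h2 h12 with ⟨hemp, heq⟩ | ⟨e, he, hmin, heq⟩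
  · rw [heq, sub_self]; simp [hemp]
  · -- continue from a point slightly above the lowest edge met
    have hhigh : ∀ᶠ t in 𝓝[>] (0 : ℝ), ∀ g ∈ G.crossed l x y₁ y₂, g ≠ e →
        G.ht l e x + t < G.ht l g x := by
      rw [Filter.eventually_all]
      intro g
      by_cases hg : g ∈ G.crossed l x y₁ y₂ ∧ g ≠ e
      · have hlt : G.ht l e x < G.ht l g x :=
          lt_of_le_of_ne (hmin g hg.1) (ht_ne_ht hl he.1 hg.1.1 hg.2)
        filter_upwards [Ioo_mem_nhdsGT (sub_pos.2 hlt)] with t ht _ _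
        linarith [ht.2]
      · exact Filter.Eventually.of_forall fun t h1 h2 => absurd ⟨h1, h2⟩ hg
    obtain ⟨t, ⟨⟨htC, htF⟩, hth⟩, ht0, ht1⟩ := (((eventually_sideFace hl true e he.1).and hhigh).and
      (Ioo_mem_nhdsGT (sub_pos.2 he.2.2))).exists
    simp only [sg_true, one_mul] at htC htF
    have hset : Finset.univ.filter (· ∈ G.crossed l x (G.ht l e x + t) y₂) =
        (Finset.univ.filter (· ∈ G.crossed l x y₁ y₂)).erase e := by
      ext g
      simp only [Finset.mem_filter, Finset.mem_univ, true_and, Finset.mem_erase]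
      constructor
      · rintro ⟨ha, hb, hc⟩
        refine ⟨?_, ha, by linarith [he.2.1], hc⟩
        rintro rfl; linarith
      · rintro ⟨ha, hb⟩
        exact ⟨hb.1, hth g hb ha, hb.2.2⟩
    have hmem : e ∈ Finset.univ.filter (· ∈ G.crossed l x y₁ y₂) := by simpa using he
    have hcard := Finset.card_erase_lt_of_mem hmem
    have := ih _ (by rw [← hk, hset]; exact hcard) (y₁ := G.ht l e x + t)
      (by linarith [he.2.1]) htC (by linarith) rfl
    rw [hset, htF] at this
    rw [← Finset.add_sum_erase _ _ hmem, this, heq, jump]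
    abel

/-! ### Faces close to a vertex -/

/-- Within distance `η` of the vertex `v`, the vertical line through `v` meets the lines carrying
the edges only in `v` itself; if `v` is internal, it lies higher than `η`. -/
structure IsWindow (G : PlabicGraph n W E) (l : ℂ) (v : Fin n ⊕ W) (η : ℝ) : Prop where
  pos : 0 < η
  ht_eq : ∀ e, |G.ht l e (G.vx l v) - (G.pos v).im| ≤ η → G.ht l e (G.vx l v) = (G.pos v).im
  lt_im : ∀ w, v = Sum.inr w → η < (G.pos v).im

lemma eventually_isWindow (v : Fin n ⊕ W) : ∀ᶠ η in 𝓝[>] (0 : ℝ), G.IsWindow l v η := by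
  have h1 : ∀ᶠ η in 𝓝[>] (0 : ℝ), ∀ e,
      |G.ht l e (G.vx l v) - (G.pos v).im| ≤ η → G.ht l e (G.vx l v) = (G.pos v).im := by
    rw [Filter.eventually_all]
    intro e
    by_cases h : G.ht l e (G.vx l v) = (G.pos v).im
    · exact Filter.Eventually.of_forall fun _ _ => h
    · filter_upwards [Ioo_mem_nhdsGT (abs_pos.2 (sub_ne_zero.2 h))] with η hη hle
      linarith [hη.2]
  have h2 : ∀ᶠ η in 𝓝[>] (0 : ℝ), ∀ w, v = Sum.inr w → η < (G.pos v).im := by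
    rcases v with i | w
    · simp
    · filter_upwards [Ioo_mem_nhdsGT (G.internal_im w)] with η hη _ _ using hη.2
  filter_upwards [h1, h2, self_mem_nhdsWithin] with η h1 h2 h3 using ⟨h3, h1, h2⟩

/-- The vertical direction `s` points into the half-plane at the vertex `v`. -/
def PointsIn (s : Bool) (v : Fin n ⊕ W) : Prop := s = true ∨ ∃ w, v = Sum.inr w

lemma IsWindow.im_pos {v : Fin n ⊕ W} {η : ℝ} (h : G.IsWindow l v η) {s : Bool}
    (hs : PointsIn s v) {t : ℝ} (ht : 0 < t) (htη : t ≤ η) : 0 < (G.pos v).im + sg s * t := by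
  have := im_pos_nonneg (G := G) v
  rcases hs with rfl | ⟨w, hw⟩
  · simp only [sg_true]; linarith
  · have := h.lt_im w hw
    cases s <;> simp only [sg_true, sg_false] <;> linarith

lemma IsWindow.mem (hl : G.IsGaugeDirection l) {v : Fin n ⊕ W} {η : ℝ} (h : G.IsWindow l v η)
    {s : Bool} (hs : PointsIn s v) {t : ℝ} (ht : 0 < t) (htη : t ≤ η) :
    pointAt l (G.vx l v) ((G.pos v).im + sg s * t) ∈ G.graphComplement := by
  refine mem_graphComplement.2 ⟨h.im_pos hs ht htη, fun e he => ?_⟩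
  rw [mem_edgeSeg hl, absc_pointAt hl.inward, pointAt_im] at he
  have := h.ht_eq e (by
    rw [← he.2, add_sub_cancel_left, abs_mul, abs_of_pos ht]
    cases s <;> simpa)
  rw [← he.2] at this
  have h0 : sg s * t = 0 := by linarith
  exact mul_ne_zero (sg_ne_zero s) ht.ne' h0

lemma IsWindow.faceAt_eq (hl : G.IsGaugeDirection l) {v : Fin n ⊕ W} {η : ℝ}
    (h : G.IsWindow l v η) {s : Bool} (hs : PointsIn s v) {t : ℝ} (ht : 0 < t) (htη : t ≤ η) :
    G.faceAt (pointAt l (G.vx l v) ((G.pos v).im + sg s * t)) =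
      G.faceAt (pointAt l (G.vx l v) ((G.pos v).im + sg s * η)) := by
  have hcont : Continuous fun t => pointAt l (G.vx l v) ((G.pos v).im + sg s * t) := by fun_prop
  apply faceAt_eq_of_preconnected
    (isPreconnected_Icc.image (f := fun t => pointAt l (G.vx l v) ((G.pos v).im + sg s * t))
      (s := Set.Icc t η) hcont.continuousOn)
  · rintro _ ⟨t', ht', rfl⟩
    exact h.mem hl hs (ht.trans_le ht'.1) ht'.2
  · exact ⟨t, ⟨le_rfl, htη⟩, rfl⟩
  · exact ⟨η, ⟨htη, le_rfl⟩, rfl⟩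

/-- The face just above (`s = true`) or just below (`s = false`) the vertex `v`. For a boundary
vertex only the first makes sense. -/
def vertexFace (G : PlabicGraph n W E) (l : ℂ) (s : Bool) (v : Fin n ⊕ W) : Set ℂ :=
  G.faceAt (pointAt l (G.vx l v)
    ((G.pos v).im + sg s * (eventually_isWindow (G := G) (l := l) v).exists.choose))

lemma IsWindow.faceAt_eq_vertexFace (hl : G.IsGaugeDirection l) {v : Fin n ⊕ W} {η : ℝ}
    (h : G.IsWindow l v η) {s : Bool} (hs : PointsIn s v) :
    G.faceAt (pointAt l (G.vx l v) ((G.pos v).im + sg s * η)) = G.vertexFace l s v := by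
  have h' := (eventually_isWindow (G := G) (l := l) v).exists.choose_spec
  rw [vertexFace]
  set η' := (eventually_isWindow (G := G) (l := l) v).exists.choose
  rcases le_total η η' with hle | hle
  · exact h'.faceAt_eq hl hs h.pos hle
  · exact (h.faceAt_eq hl hs h'.pos hle).symm

/-- What a vertical line at the small distance `δ` to the right (`s = true`) or to the left
(`s = false`) of the vertex `v` meets at heights close to that of `v`. -/
structure IsGoodOffset (G : PlabicGraph n W E) (l : ℂ) (s : Bool) (v : Fin n ⊕ W) (η δ : ℝ) :
    Prop where
  pos : 0 < δ
  clean : G.IsClean l (G.vx l v + sg s * δ)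
  spans : ∀ e, G.nend l s e = v → G.Spans l e (G.vx l v + sg s * δ)
  near : ∀ e, G.nend l s e = v → |G.ht l e (G.vx l v + sg s * δ) - (G.pos v).im| < η
  eq_of_near : ∀ e, G.Spans l e (G.vx l v + sg s * δ) →
    |G.ht l e (G.vx l v + sg s * δ) - (G.pos v).im| ≤ η → G.nend l s e = v
  face : ∀ s', PointsIn s' v →
    pointAt l (G.vx l v + sg s * δ) ((G.pos v).im + sg s' * η) ∈ G.graphComplement ∧
    G.faceAt (pointAt l (G.vx l v + sg s * δ) ((G.pos v).im + sg s' * η)) = G.vertexFace l s' v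

lemma tendsto_offset (s : Bool) (x : ℝ) : Tendsto (fun δ => x + sg s * δ) (𝓝[>] 0) (𝓝 x) := by
  have : Continuous fun δ : ℝ => x + sg s * δ := by fun_prop
  simpa using (this.tendsto 0).mono_left nhdsWithin_le_nhds

lemma nend_not (hl : G.IsGaugeDirection l) (s : Bool) (e : E) :
    0 < sg s * (G.vx l (G.nend l (!s) e) - G.vx l (G.nend l s e)) := by
  have := nend_lt hl e
  cases s <;> simp <;> linarith

lemma spans_iff (s : Bool) (e : E) (x : ℝ) : G.Spans l e x ↔
    0 < sg s * (x - G.vx l (G.nend l s e)) ∧ 0 < sg s * (G.vx l (G.nend l (!s) e) - x) := by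
  cases s <;> simp [Spans, and_comm]

lemma eventually_isGoodOffset (hl : G.IsGaugeDirection l) (s : Bool) {v : Fin n ⊕ W} {η : ℝ}
    (h : G.IsWindow l v η) : ∀ᶠ δ in 𝓝[>] (0 : ℝ), G.IsGoodOffset l s v η δ := by
  have hclean : ∀ᶠ δ in 𝓝[>] (0 : ℝ), G.IsClean l (G.vx l v + sg s * δ) := by
    unfold IsClean
    rw [Filter.eventually_all]
    intro w
    by_cases hw : G.vx l (Sum.inr w) = G.vx l v
    · filter_upwards [self_mem_nhdsWithin] with δ hδ heq
      have : sg s * δ = 0 := by linarith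
      exact mul_ne_zero (sg_ne_zero s) (ne_of_gt hδ) this
    · exact ((tendsto_offset s _).eventually (isOpen_ne.mem_nhds (Ne.symm hw))).mono
        fun _ h => Ne.symm h
  have hspans : ∀ᶠ δ in 𝓝[>] (0 : ℝ), ∀ e, G.nend l s e = v →
      G.Spans l e (G.vx l v + sg s * δ) := by
    rw [Filter.eventually_all]
    intro e
    by_cases he : G.nend l s e = v
    · subst he
      filter_upwards [Ioo_mem_nhdsGT (nend_not hl s e)] with δ hδ _
      rw [spans_iff s]
      have := sg_mul_self s
      constructor
      · linarith [hδ.1, show sg s * (G.vx l (G.nend l s e) + sg s * δ - G.vx l (G.nend l s e)) = δ by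
          linear_combination δ * this]
      · linarith [hδ.2, show sg s * (G.vx l (G.nend l (!s) e) - (G.vx l (G.nend l s e) + sg s * δ)) =
          sg s * (G.vx l (G.nend l (!s) e) - G.vx l (G.nend l s e)) - δ by
          linear_combination -δ * this]
    · exact Filter.Eventually.of_forall fun _ h => absurd h he
  have hcont : ∀ e, Tendsto (fun δ => |G.ht l e (G.vx l v + sg s * δ) - (G.pos v).im|) (𝓝[>] 0)
      (𝓝 |G.ht l e (G.vx l v) - (G.pos v).im|) := fun e =>
    (((continuous_ht e).tendsto _).comp (tendsto_offset s _)).sub_const _ |>.abs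
  have hnear : ∀ᶠ δ in 𝓝[>] (0 : ℝ), ∀ e, G.nend l s e = v →
      |G.ht l e (G.vx l v + sg s * δ) - (G.pos v).im| < η := by
    rw [Filter.eventually_all]
    intro e
    by_cases he : G.nend l s e = v
    · have h0 : |G.ht l e (G.vx l v) - (G.pos v).im| < η := by
        rw [← he, ht_nend hl]; simpa using h.pos
      filter_upwards [(hcont e).eventually (isOpen_Iio.mem_nhds h0)] with δ hδ _ using hδ
    · exact Filter.Eventually.of_forall fun _ h => absurd h he
  have heq : ∀ᶠ δ in 𝓝[>] (0 : ℝ), ∀ e, G.Spans l e (G.vx l v + sg s * δ) →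
      |G.ht l e (G.vx l v + sg s * δ) - (G.pos v).im| ≤ η → G.nend l s e = v := by
    rw [Filter.eventually_all]
    intro e
    by_cases he : G.nend l s e = v
    · exact Filter.Eventually.of_forall fun _ _ _ => he
    by_cases hη : |G.ht l e (G.vx l v) - (G.pos v).im| ≤ η
    · -- the line carrying `e` passes through `v`, but `e` does not start there in direction `s`
      have hv := h.ht_eq e hη
      by_cases hin : G.vx l (G.nend l true e) ≤ G.vx l v ∧ G.vx l v ≤ G.vx l (G.nend l false e)
      · have hmem : G.pos v ∈ G.edgeSeg e := by rw [mem_edgeSeg hl]; exact ⟨hin, hv.symm⟩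
        obtain ⟨s', hs'⟩ := nend_of_mem_edgeSeg hl hmem
        obtain rfl : s' = !s := by
          cases s <;> cases s' <;> simp_all
        filter_upwards [self_mem_nhdsWithin] with δ hδ hsp
        rw [spans_iff s, hs'] at hsp
        have h2 := hsp.2
        have := sg_mul_self s
        have hδ' : (0 : ℝ) < δ := hδ
        nlinarith
      · have hout : ∀ᶠ δ in 𝓝[>] (0 : ℝ), ¬ (G.vx l (G.nend l true e) ≤ G.vx l v + sg s * δ ∧
            G.vx l v + sg s * δ ≤ G.vx l (G.nend l false e)) :=
          (tendsto_offset s _).eventually (isClosed_Icc.isOpen_compl.mem_nhds hin)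
        filter_upwards [hout] with δ hδ hsp
        exact absurd ⟨hsp.1.le, hsp.2.le⟩ hδ
    · filter_upwards [(hcont e).eventually (isOpen_Ioi.mem_nhds (not_le.1 hη))] with δ hδ _ hle
      exact absurd hle (not_le.2 hδ)
  have hface : ∀ᶠ δ in 𝓝[>] (0 : ℝ), ∀ s', PointsIn s' v →
      pointAt l (G.vx l v + sg s * δ) ((G.pos v).im + sg s' * η) ∈ G.graphComplement ∧
      G.faceAt (pointAt l (G.vx l v + sg s * δ) ((G.pos v).im + sg s' * η)) =
        G.vertexFace l s' v := by
    rw [Filter.eventually_all]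
    intro s'
    by_cases hs' : PointsIn s' v
    · have hc : Continuous fun x => pointAt l x ((G.pos v).im + sg s' * η) := by fun_prop
      have := ((hc.tendsto _).comp (tendsto_offset s (G.vx l v))).eventually
        (eventually_faceAt_eq (h.mem hl hs' h.pos le_rfl))
      filter_upwards [this] with δ hδ _
      rw [← h.faceAt_eq_vertexFace hl hs']
      exact hδ
    · exact Filter.Eventually.of_forall fun _ h => absurd h hs'
  filter_upwards [hclean, hspans, hnear, heq, hface, self_mem_nhdsWithin] with δ a b c d e f
  exact ⟨f, a, b, c, d, e⟩

/-- Close to a common end, edges on the same side are ordered by height as by slope, up to the sign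
of the side. -/
lemma ht_lt_iff (hl : G.IsGaugeDirection l) {s : Bool} {v : Fin n ⊕ W} {e f : E}
    (he : G.nend l s e = v) (hf : G.nend l s f = v) {δ : ℝ} (hδ : 0 < δ) :
    G.ht l e (G.vx l v + sg s * δ) < G.ht l f (G.vx l v + sg s * δ) ↔
      sg s * G.slope l e < sg s * G.slope l f := by
  rw [ht_eq hl s e, ht_eq hl s f, he, hf]
  have h1 : ∀ a : ℝ, a * (G.vx l v + sg s * δ - G.vx l v) = δ * (sg s * a) := fun a => by ring
  rw [h1, h1, add_lt_add_iff_left, mul_lt_mul_iff_right₀ hδ]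

lemma slope_ne (hl : G.IsGaugeDirection l) {s : Bool} {e f : E}
    (h : G.nend l s e = G.nend l s f) (hef : f ≠ e) : sg s * G.slope l e ≠ sg s * G.slope l f := by
  intro heq
  obtain ⟨η, hη⟩ := (eventually_isWindow (G := G) (l := l) (G.nend l s f)).exists
  obtain ⟨δ, hδ⟩ := (eventually_isGoodOffset hl s hη).exists
  apply ht_ne_ht hl (hδ.spans e h) (hδ.spans f rfl) hef
  have h1 := ht_lt_iff hl h rfl hδ.pos
  have h2 := ht_lt_iff hl rfl h hδ.pos
  rw [heq] at h1 h2
  simp only [lt_irrefl, iff_false, not_lt] at h1 h2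
  exact le_antisymm h2 h1

section
open Classical

variable {A : Type*} [AddCommGroup A]

/-- The half-edges on either side of an internal vertex have the same total jump, because a vertical
segment passing close to the vertex on this side goes from the face below it to the face above. -/
lemma sum_jump_side (hl : G.IsGaugeDirection l) (f : Set ℂ → A) (s : Bool) (w : W) :
    ∑ e with G.nend l s e = Sum.inr w, G.jump l f e =
      f (G.vertexFace l true (Sum.inr w)) - f (G.vertexFace l false (Sum.inr w)) := by
  obtain ⟨η, hη⟩ := (eventually_isWindow (G := G) (l := l) (Sum.inr w)).exists
  obtain ⟨δ, hδ⟩ := (eventually_isGoodOffset hl s hη).exists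
  have ht := hδ.face true (Or.inr ⟨w, rfl⟩)
  have hb := hδ.face false (Or.inr ⟨w, rfl⟩)
  have hpos := hη.im_pos (s := false) (Or.inr ⟨w, rfl⟩) hη.pos le_rfl
  simp only [sg_true, sg_false] at ht hb hpos
  rw [← ht.2, ← hb.2, ← sum_jump_crossed hl f hδ.clean hpos hb.1 ht.1 (by linarith [hη.pos])]
  congr 1
  ext e
  simp only [Finset.mem_filter, Finset.mem_univ, true_and]
  constructor
  · intro he
    have := abs_lt.1 (hδ.near e he)
    exact ⟨hδ.spans e he, by linarith, by linarith⟩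
  · rintro ⟨h1, h2, h3⟩
    exact hδ.eq_of_near e h1 (abs_le.2 ⟨by linarith, by linarith⟩)

lemma sum_jump_above (hl : G.IsGaugeDirection l) (f : Set ℂ → A) (s : Bool) {v : Fin n ⊕ W} {e : E}
    (he : G.nend l s e = v) :
    ∑ e' with G.nend l s e' = v ∧ sg s * G.slope l e < sg s * G.slope l e', G.jump l f e' =
      f (G.vertexFace l true v) - f (G.sideFace l true e) := by
  obtain ⟨η, hη⟩ := (eventually_isWindow (G := G) (l := l) v).exists
  obtain ⟨δ, hδ⟩ := (eventually_isGoodOffset hl s hη).exists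
  have ht := hδ.face true (Or.inl rfl)
  simp only [sg_true] at ht
  set x := G.vx l v + sg s * δ with hx
  have hhigh : ∀ᶠ t in 𝓝[>] (0 : ℝ), ∀ e', G.ht l e x < G.ht l e' x →
      G.ht l e x + t < G.ht l e' x := by
    rw [Filter.eventually_all]
    intro e'
    by_cases h : G.ht l e x < G.ht l e' x
    · filter_upwards [Ioo_mem_nhdsGT (sub_pos.2 h)] with t ht _
      linarith [ht.2]
    · exact Filter.Eventually.of_forall fun _ h' => absurd h' h
  have hnear := abs_lt.1 (hδ.near e he)
  obtain ⟨t, ⟨⟨htC, htF⟩, hth⟩, ht0, ht1⟩ :=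
    (((eventually_sideFace hl true e (hδ.spans e he)).and hhigh).and
      (Ioo_mem_nhdsGT (show 0 < (G.pos v).im + η - G.ht l e x by linarith))).exists
  simp only [sg_true, one_mul] at htC htF ht
  have hp := ht_pos_of_spans hl (hδ.spans e he)
  rw [← htF, ← ht.2, ← sum_jump_crossed hl f hδ.clean (by linarith) htC ht.1 (by linarith)]
  congr 1
  ext e'
  simp only [Finset.mem_filter, Finset.mem_univ, true_and]
  constructor
  · rintro ⟨h1, h2⟩
    rw [← ht_lt_iff hl he h1 hδ.pos] at h2
    have := abs_lt.1 (hδ.near e' h1)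
    exact ⟨hδ.spans e' h1, hth e' h2, by linarith⟩
  · rintro ⟨h1, h2, h3⟩
    have h4 := hδ.eq_of_near e' h1 (abs_le.2 ⟨by linarith, by linarith⟩)
    exact ⟨h4, (ht_lt_iff hl he h4 hδ.pos).1 (by linarith)⟩

lemma sum_jump_below (hl : G.IsGaugeDirection l) (f : Set ℂ → A) (s : Bool) {w : W} {e : E}
    (he : G.nend l s e = Sum.inr w) :
    ∑ e' with G.nend l s e' = Sum.inr w ∧ sg s * G.slope l e' < sg s * G.slope l e,
      G.jump l f e' =
      f (G.sideFace l false e) - f (G.vertexFace l false (Sum.inr w)) := by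
  obtain ⟨η, hη⟩ := (eventually_isWindow (G := G) (l := l) (Sum.inr w)).exists
  obtain ⟨δ, hδ⟩ := (eventually_isGoodOffset hl s hη).exists
  have hb := hδ.face false (Or.inr ⟨w, rfl⟩)
  have hpos := hη.im_pos (s := false) (Or.inr ⟨w, rfl⟩) hη.pos le_rfl
  simp only [sg_false] at hb hpos
  set x := G.vx l (Sum.inr w) + sg s * δ with hx
  have hlow : ∀ᶠ t in 𝓝[>] (0 : ℝ), ∀ e', G.ht l e' x < G.ht l e x →
      G.ht l e' x < G.ht l e x - t := by
    rw [Filter.eventually_all]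
    intro e'
    by_cases h : G.ht l e' x < G.ht l e x
    · filter_upwards [Ioo_mem_nhdsGT (sub_pos.2 h)] with t ht _
      linarith [ht.2]
    · exact Filter.Eventually.of_forall fun _ h' => absurd h' h
  have hnear := abs_lt.1 (hδ.near e he)
  obtain ⟨t, ⟨⟨htC, htF⟩, hth⟩, ht0, ht1⟩ :=
    (((eventually_sideFace hl false e (hδ.spans e he)).and hlow).and
      (Ioo_mem_nhdsGT (show 0 < G.ht l e x - ((G.pos (Sum.inr w)).im - η) by linarith))).exists
  simp only [sg_false] at htC htF
  have hp := ht_pos_of_spans hl (hδ.spans e he)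
  rw [← htF, ← hb.2, ← sum_jump_crossed hl f hδ.clean hpos hb.1 htC (by linarith)]
  congr 1
  ext e'
  simp only [Finset.mem_filter, Finset.mem_univ, true_and]
  constructor
  · rintro ⟨h1, h2⟩
    rw [← ht_lt_iff hl h1 he hδ.pos] at h2
    have := abs_lt.1 (hδ.near e' h1)
    exact ⟨hδ.spans e' h1, by linarith, by linarith [hth e' h2]⟩
  · rintro ⟨h1, h2, h3⟩
    have h4 := hδ.eq_of_near e' h1 (abs_le.2 ⟨by linarith, by linarith⟩)
    exact ⟨h4, (ht_lt_iff hl h4 he hδ.pos).1 (by linarith)⟩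

end

/-- Close to an internal vertex and off the vertical line through it, a point of the complement lies
just above the vertex or just below one of its edges. -/
lemma eventually_faceAt_near_vertex (hl : G.IsGaugeDirection l) (w : W) :
    ∀ᶠ z in 𝓝 (G.pos (Sum.inr w)), z ∈ G.graphComplement → absc l z ≠ G.vx l (Sum.inr w) →
      G.faceAt z = G.vertexFace l true (Sum.inr w) ∨
        ∃ e s, G.nend l s e = Sum.inr w ∧ G.faceAt z = G.sideFace l false e := by
  obtain ⟨η, hη⟩ := (eventually_isWindow (G := G) (l := l) (Sum.inr w)).exists
  have hgood : ∀ᶠ δ in 𝓝[>] (0 : ℝ), ∀ s, G.IsGoodOffset l s (Sum.inr w) η δ :=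
    Filter.eventually_all.2 fun s => eventually_isGoodOffset hl s hη
  obtain ⟨ε, hε, hsub⟩ := mem_nhdsGT_iff_exists_Ioo_subset.1 hgood
  have h1 : ∀ᶠ z in 𝓝 (G.pos (Sum.inr w)), |absc l z - G.vx l (Sum.inr w)| < ε := by
    have hc : Continuous fun z => |absc l z - G.vx l (Sum.inr w)| := by fun_prop
    apply (isOpen_Iio.preimage hc).mem_nhds
    simpa using hε
  have h2 : ∀ᶠ z in 𝓝 (G.pos (Sum.inr w)), |z.im - (G.pos (Sum.inr w)).im| < η := by
    have hc : Continuous fun z : ℂ => |z.im - (G.pos (Sum.inr w)).im| := by fun_prop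
    apply (isOpen_Iio.preimage hc).mem_nhds
    simpa using hη.pos
  filter_upwards [h1, h2] with z hz1 hz2 hzC hne
  have hpos : 0 < |absc l z - G.vx l (Sum.inr w)| := abs_pos.2 (sub_ne_zero.2 hne)
  obtain ⟨s, hs⟩ : ∃ s, absc l z = G.vx l (Sum.inr w) + sg s * |absc l z - G.vx l (Sum.inr w)| := by
    rcases abs_cases (absc l z - G.vx l (Sum.inr w)) with ⟨h, -⟩ | ⟨h, -⟩ <;> rw [h]
    · exact ⟨true, by simp⟩
    · exact ⟨false, by simp⟩
  have hδ := hsub ⟨hpos, hz1⟩ s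
  set δ := |absc l z - G.vx l (Sum.inr w)|
  have ht := hδ.face true (Or.inr ⟨w, rfl⟩)
  simp only [sg_true] at ht
  have hzz : pointAt l (G.vx l (Sum.inr w) + sg s * δ) z.im = z := by
    rw [← hs, pointAt_absc_im hl.inward]
  have hz2' := abs_lt.1 hz2
  rcases going_up hl hδ.clean (mem_graphComplement.1 hzC).1 (by rwa [hzz]) ht.1 (by linarith)
    with ⟨-, h⟩ | ⟨e, he, -, h⟩
  · left; rw [← ht.2, ← h, hzz]
  · right
    refine ⟨e, s, hδ.eq_of_near e he.1 (abs_le.2 ⟨by linarith [he.2.1], by linarith [he.2.2]⟩), ?_⟩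
    rw [← h, hzz]

/-! ### The face at infinity and the ceilings of points -/

/-- The graph lies in the box given by `|absc| < M` and `im < M`. -/
def IsGraphBound (G : PlabicGraph n W E) (l : ℂ) (M : ℝ) : Prop :=
  0 < M ∧ ∀ e, ∀ z ∈ G.edgeSeg e, |absc l z| < M ∧ z.im < M

lemma exists_isGraphBound (G : PlabicGraph n W E) (l : ℂ) : ∃ M, G.IsGraphBound l M := by
  have hc : IsCompact (⋃ e, G.edgeSeg e) := by
    apply isCompact_iUnion
    intro e
    rw [edgeSeg, segment_eq_image_lineMap]
    exact isCompact_Icc.image AffineMap.lineMap_continuous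
  obtain ⟨A, hA⟩ := hc.exists_bound_of_continuousOn (continuous_absc l).continuousOn
  obtain ⟨B, hB⟩ := hc.exists_bound_of_continuousOn Complex.continuous_im.continuousOn
  refine ⟨|A| + |B| + 1, by positivity, fun e z hz => ⟨?_, ?_⟩⟩
  · have := hA z (Set.mem_iUnion_of_mem e hz)
    rw [Real.norm_eq_abs] at this
    linarith [le_abs_self A, abs_nonneg B]
  · have := hB z (Set.mem_iUnion_of_mem e hz)
    rw [Real.norm_eq_abs] at this
    linarith [le_abs_self B, abs_nonneg A, le_abs_self z.im]

/-- The face that contains all points of large height. -/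
def topFace (G : PlabicGraph n W E) (l : ℂ) : Set ℂ :=
  G.faceAt (pointAt l 0 (exists_isGraphBound G l).choose)

lemma convex_high (M : ℝ) : Convex ℝ {z : ℂ | M ≤ z.im} := convex_halfSpace_im_ge M

lemma faceAt_high {M : ℝ} (hM : G.IsGraphBound l M) {z : ℂ} (hz : M ≤ z.im) :
    z ∈ G.graphComplement ∧ G.faceAt z = G.topFace l := by
  have hM' := (exists_isGraphBound G l).choose_spec
  rw [topFace]
  set M' := (exists_isGraphBound G l).choose
  have key : ∀ M, G.IsGraphBound l M → {z : ℂ | M ≤ z.im} ⊆ G.graphComplement := fun M hM z hz =>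
    mem_graphComplement.2 ⟨hM.1.trans_le hz, fun e he => absurd (hM.2 e z he).2 (not_lt.2 hz)⟩
  refine ⟨key M hM hz, ?_⟩
  have hm : G.IsGraphBound l (min M M') := by
    rcases min_choice M M' with h | h <;> rw [h] <;> assumption
  exact faceAt_eq_of_preconnected (convex_high _).isPreconnected (key _ hm)
    (show min M M' ≤ z.im from (min_le_left _ _).trans hz) (min_le_right M M')

/-- The points to the left or to the right of the whole graph lie in the top face as well. -/
lemma faceAt_wide (hl : G.IsGaugeDirection l) {M : ℝ} (hM : G.IsGraphBound l M) {z : ℂ}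
    (hz : 0 < z.im) (hzM : M ≤ |absc l z|) : G.faceAt z = G.topFace l := by
  rw [← (faceAt_high hM (z := pointAt l (absc l z) (max z.im M)) (le_max_right _ _)).2]
  conv_lhs => rw [← pointAt_absc_im hl.inward z]
  refine faceAt_eq_of_vertical (fun y hy => mem_graphComplement.2 ⟨hz.trans_le hy.1, ?_⟩)
    (le_max_left _ _)
  intro e he
  have := (hM.2 e _ he).1
  rw [absc_pointAt hl.inward] at this
  exact absurd this (not_lt.2 hzM)

lemma isFace_faceAt {z : ℂ} (hz : z ∈ G.graphComplement) : G.IsFace (G.faceAt z) := ⟨z, hz, rfl⟩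

lemma IsFace.eq_faceAt {Ω : Set ℂ} (h : G.IsFace Ω) {z : ℂ} (hz : z ∈ Ω) : Ω = G.faceAt z := by
  obtain ⟨z₀, hz₀, rfl⟩ := h
  exact (faceAt_eq_of_mem hz).symm

lemma not_isBounded_topFace : ¬ Bornology.IsBounded (G.topFace l) := by
  intro h
  obtain ⟨M, hM⟩ := exists_isGraphBound G l
  obtain ⟨R, hR⟩ := h.exists_norm_le
  have h1 := faceAt_high hM (z := pointAt l 0 (max M (R + 1))) (le_max_left _ _)
  have h2 := hR _ (h1.2 ▸ mem_faceAt_self h1.1)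
  have h3 := (Complex.abs_im_le_norm _).trans h2
  rw [pointAt_im] at h3
  linarith [le_abs_self (max M (R + 1)), le_max_right M (R + 1)]

lemma IsFace.eq_topFace_of_not_isBounded (hl : G.IsGaugeDirection l) {Ω : Set ℂ} (h : G.IsFace Ω)
    (hb : ¬ Bornology.IsBounded Ω) : Ω = G.topFace l := by
  obtain ⟨M, hM⟩ := exists_isGraphBound G l
  by_contra hne
  apply hb
  have hc : IsCompact ((fun p : ℝ × ℝ => pointAt l p.1 p.2) '' (Set.Icc (-M) M ×ˢ Set.Icc 0 M)) :=
    (isCompact_Icc.prod isCompact_Icc).image (continuous_pointAt l)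
  refine hc.isBounded.subset fun z hz => ?_
  have hzf := h.eq_faceAt hz
  have hz0 : 0 < z.im := by
    obtain ⟨z₀, -, rfl⟩ := h
    exact (mem_graphComplement.1 (faceAt_subset _ hz)).1
  refine ⟨(absc l z, z.im), ⟨abs_le.1 ?_, hz0.le, ?_⟩, pointAt_absc_im hl.inward z⟩
  · by_contra hlt
    exact hne (hzf.trans (faceAt_wide hl hM hz0 (not_le.1 hlt).le))
  · by_contra hlt
    exact hne (hzf.trans (faceAt_high hM (not_le.1 hlt).le).2)

/-- The edges that pass strictly above the point `z`. -/
def edgesAbove (G : PlabicGraph n W E) (l : ℂ) (z : ℂ) : Set E :=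
  {e | G.Spans l e (absc l z) ∧ z.im < G.ht l e (absc l z)}

open Classical in
/-- The ceiling of a point: the lowest edge that passes strictly above it, or `none`. -/
def ceiling (G : PlabicGraph n W E) (l : ℂ) (z : ℂ) : Option E :=
  if h : (G.edgesAbove l z).Nonempty then
    some (Set.exists_min_image (G.edgesAbove l z) (fun e => G.ht l e (absc l z))
      (Set.toFinite _) h).choose
  else none

lemma ceiling_eq_none {z : ℂ} (h : G.edgesAbove l z = ∅) : G.ceiling l z = none := by
  rw [ceiling, dif_neg (by simp [h])]

lemma ceiling_eq_some (hl : G.IsGaugeDirection l) {z : ℂ} {e : E} (he : e ∈ G.edgesAbove l z)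
    (hmin : ∀ f ∈ G.edgesAbove l z, G.ht l e (absc l z) ≤ G.ht l f (absc l z)) :
    G.ceiling l z = some e := by
  have hne : (G.edgesAbove l z).Nonempty := ⟨e, he⟩
  rw [ceiling, dif_pos hne]
  have hspec := (Set.exists_min_image (G.edgesAbove l z) (fun e => G.ht l e (absc l z))
      (Set.toFinite _) hne).choose_spec
  set f := (Set.exists_min_image (G.edgesAbove l z) (fun e => G.ht l e (absc l z))
      (Set.toFinite _) hne).choose
  congr 1
  by_contra hfe
  exact ht_ne_ht hl he.1 hspec.1.1 hfe (le_antisymm (hmin f hspec.1) (hspec.2 e he))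

lemma ceiling_spec (hl : G.IsGaugeDirection l) (z : ℂ) :
    (G.edgesAbove l z = ∅ ∧ G.ceiling l z = none) ∨ ∃ e ∈ G.edgesAbove l z,
      (∀ f ∈ G.edgesAbove l z, G.ht l e (absc l z) ≤ G.ht l f (absc l z)) ∧
        G.ceiling l z = some e := by
  rcases (G.edgesAbove l z).eq_empty_or_nonempty with h | h
  · exact Or.inl ⟨h, ceiling_eq_none h⟩
  · obtain ⟨e, he, hmin⟩ := Set.exists_min_image (G.edgesAbove l z)
      (fun e => G.ht l e (absc l z)) (Set.toFinite _) h
    exact Or.inr ⟨e, he, hmin, ceiling_eq_some hl he hmin⟩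

/-- The face just below a ceiling. -/
def belowFace (G : PlabicGraph n W E) (l : ℂ) : Option E → Set ℂ
  | none => G.topFace l
  | some e => G.sideFace l false e

lemma faceAt_eq_belowFace_ceiling (hl : G.IsGaugeDirection l) {z : ℂ} (hz : z ∈ G.graphComplement)
    (hc : G.IsClean l (absc l z)) : G.faceAt z = G.belowFace l (G.ceiling l z) := by
  obtain ⟨M, hM⟩ := exists_isGraphBound G l
  have hh := faceAt_high hM (z := pointAt l (absc l z) (max z.im M)) (le_max_right _ _)
  have hab : G.crossed l (absc l z) z.im (max z.im M) = G.edgesAbove l z := by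
    ext e
    constructor
    · rintro ⟨h1, h2, -⟩; exact ⟨h1, h2⟩
    · rintro ⟨h1, h2⟩
      exact ⟨h1, h2, lt_max_of_lt_right (hM.2 e _ (pointAt_mem_edgeSeg hl h1)).2⟩
  have hgo := going_up hl hc (mem_graphComplement.1 hz).1 (by rwa [pointAt_absc_im hl.inward]) hh.1
    (le_max_left _ _)
  rw [hab, pointAt_absc_im hl.inward] at hgo
  rcases hgo with ⟨h, h'⟩ | ⟨e, he, hmin, h'⟩
  · rw [ceiling_eq_none h, h', hh.2]; rfl
  · rw [ceiling_eq_some hl he hmin, h']; rfl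

/-- Off the vertical lines through vertices, the ceiling is locally constant. -/
lemma eventually_ceiling_eq (hl : G.IsGaugeDirection l) {z : ℂ} (hz : z ∈ G.graphComplement)
    (hgen : ∀ v, G.vx l v ≠ absc l z) : ∀ᶠ z' in 𝓝 z, G.ceiling l z' = G.ceiling l z := by
  have hc := continuous_absc l
  have hin : ∀ e, e ∈ G.edgesAbove l z → ∀ᶠ z' in 𝓝 z, e ∈ G.edgesAbove l z' := by
    rintro e ⟨h1, h2⟩
    refine Filter.Eventually.and (((isOpen_spans e).preimage hc).mem_nhds h1) ?_
    exact (isOpen_lt Complex.continuous_im ((continuous_ht e).comp hc)).mem_nhds h2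
  have hout : ∀ e, e ∉ G.edgesAbove l z → ∀ᶠ z' in 𝓝 z, e ∉ G.edgesAbove l z' := by
    intro e he
    by_cases hs : G.Spans l e (absc l z)
    · have hlt : G.ht l e (absc l z) < z.im := by
        refine lt_of_le_of_ne (not_lt.1 fun h => he ⟨hs, h⟩) fun h => ?_
        exact (mem_graphComplement.1 hz).2 e ((mem_edgeSeg hl).2 ⟨⟨hs.1.le, hs.2.le⟩, h.symm⟩)
      have := (isOpen_lt ((continuous_ht (G := G) (l := l) e).comp hc)
        Complex.continuous_im).mem_nhds hlt
      filter_upwards [this] with z' hz' h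
      exact lt_asymm hz' h.2
    · have hclosed : absc l z ∉ Set.Icc (G.vx l (G.nend l true e)) (G.vx l (G.nend l false e)) :=
        fun h => hs ⟨lt_of_le_of_ne h.1 (hgen _), lt_of_le_of_ne h.2 (hgen _).symm⟩
      filter_upwards [(isClosed_Icc.isOpen_compl.preimage hc).mem_nhds hclosed] with z' hz' h
      exact hz' ⟨h.1.1.le, h.1.2.le⟩
  have hout' : ∀ᶠ z' in 𝓝 z, ∀ e, e ∉ G.edgesAbove l z → e ∉ G.edgesAbove l z' := by
    rw [Filter.eventually_all]
    intro e
    by_cases he : e ∈ G.edgesAbove l z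
    · exact Filter.Eventually.of_forall fun _ h => absurd he h
    · filter_upwards [hout e he] with z' hz' _ using hz'
  rcases ceiling_spec hl z with ⟨h, h'⟩ | ⟨e, he, hmin, h'⟩
  · filter_upwards [hout'] with z' hz'
    rw [h', ceiling_eq_none]
    ext e
    simp only [Set.mem_empty_iff_false, iff_false]
    exact hz' e (by simp [h])
  · have hlt : ∀ᶠ z' in 𝓝 z, ∀ f, f ∈ G.edgesAbove l z →
        G.ht l e (absc l z') ≤ G.ht l f (absc l z') := by
      rw [Filter.eventually_all]
      intro f
      by_cases hf : f ∈ G.edgesAbove l z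
      · rcases eq_or_ne f e with rfl | hfe
        · simp
        · have hlt := lt_of_le_of_ne (hmin f hf) (ht_ne_ht hl he.1 hf.1 hfe)
          have := (isOpen_lt ((continuous_ht (G := G) (l := l) e).comp hc)
            ((continuous_ht (G := G) (l := l) f).comp hc)).mem_nhds hlt
          filter_upwards [this] with z' hz' _ using le_of_lt hz'
      · exact Filter.Eventually.of_forall fun _ h => absurd h hf
    filter_upwards [hin e he, hout', hlt] with z' h1 h2 h3
    rw [h']
    exact ceiling_eq_some hl h1 fun f hf => h3 f (by_contra fun hf' => h2 f hf' hf)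

lemma convex_beside (s : Bool) (x : ℝ) : Convex ℝ {z : ℂ | 0 < sg s * (absc l z - x)} := by
  intro z hz w hw a b ha hb hab
  simp only [Set.mem_ofPred_eq] at *
  obtain rfl : a = 1 - b := by linarith
  rw [absc_add, absc_smul, absc_smul]
  have : sg s * ((1 - b) * absc l z + b * absc l w - x) =
      (1 - b) * (sg s * (absc l z - x)) + b * (sg s * (absc l w - x)) := by ring
  rw [this]
  rcases hb.eq_or_lt with rfl | hb'
  · simpa using hz
  · have := mul_pos hb' hw
    have := mul_nonneg ha hz.le
    linarith

lemma frequently_beside (hl : G.IsGaugeDirection l) (s : Bool) (z : ℂ) :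
    ∃ᶠ z' in 𝓝 z, 0 < sg s * (absc l z' - absc l z) := by
  have hc : Continuous fun x => pointAt l x z.im := by fun_prop
  have h1 := (hc.tendsto _).comp (tendsto_offset s (absc l z))
  rw [pointAt_absc_im hl.inward] at h1
  refine h1.frequently (Filter.Eventually.frequently ?_)
  filter_upwards [self_mem_nhdsWithin] with δ hδ
  have hδ' : (0 : ℝ) < δ := hδ
  have := sg_mul_self s
  rw [Function.comp, absc_pointAt hl.inward]
  have h2 : sg s * (absc l z + sg s * δ - absc l z) = δ := by linear_combination δ * this
  linarith

/-- Close to `z` no vertex has its abscissa strictly between that of `z` and that of the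
point considered. -/
lemma eventually_generic (z : ℂ) :
    ∀ᶠ z' in 𝓝 z, ∀ s, 0 < sg s * (absc l z' - absc l z) → ∀ v, G.vx l v ≠ absc l z' := by
  rw [Filter.eventually_all]
  intro s
  have : ∀ᶠ z' in 𝓝 z, ∀ v, 0 < sg s * (absc l z' - absc l z) → G.vx l v ≠ absc l z' := by
    rw [Filter.eventually_all]
    intro v
    by_cases hv : G.vx l v = absc l z
    · refine Filter.Eventually.of_forall fun z' h h' => ?_
      rw [← h', hv] at h
      simp at h
    · filter_upwards [(isOpen_ne.preimage (continuous_absc l)).mem_nhds (Ne.symm hv)] with z' h _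
      exact Ne.symm h
  filter_upwards [this] with z' h h1 v using h v h1

lemma exists_sideCeiling (hl : G.IsGaugeDirection l) (s : Bool) {z : ℂ}
    (hz : z ∈ G.graphComplement) :
    ∃ o, ∀ᶠ z' in 𝓝 z, 0 < sg s * (absc l z' - absc l z) → G.ceiling l z' = o := by
  obtain ⟨ε, hε, hball⟩ := Metric.eventually_nhds_iff_ball.1
    ((eventually_faceAt_eq hz).and (eventually_generic (G := G) (l := l) z))
  set S := Metric.ball z ε ∩ {z' : ℂ | 0 < sg s * (absc l z' - absc l z)} with hS
  have hpre : IsPreconnected S := ((convex_ball _ _).inter (convex_beside s _)).isPreconnected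
  obtain ⟨z₀, hz₁, hz₀⟩ :=
    ((frequently_beside hl s z).and_eventually (Metric.ball_mem_nhds z hε)).exists
  refine ⟨G.ceiling l z₀, ?_⟩
  filter_upwards [Metric.ball_mem_nhds z hε] with z' hz' hs'
  refine hpre.induction₂ (fun a b => G.ceiling l a = G.ceiling l b) (fun a ha => ?_)
    (fun a b c _ _ _ => Eq.trans) (fun a b _ _ => Eq.symm) ⟨hz', hs'⟩ ⟨hz₀, hz₁⟩
  have hb := hball a ha.1
  filter_upwards [mem_nhdsWithin_of_mem_nhds
    (eventually_ceiling_eq hl hb.1.1 (hb.2 s ha.2))] with b hb using hb.symm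

open Classical in
/-- The common ceiling of the points close to `z` and strictly to the right (`s = true`) or to the
left (`s = false`) of it. -/
def sideCeiling (G : PlabicGraph n W E) (l : ℂ) (s : Bool) (z : ℂ) : Option E :=
  if h : ∃ o, ∀ᶠ z' in 𝓝 z, 0 < sg s * (absc l z' - absc l z) → G.ceiling l z' = o then h.choose
  else none

lemma sideCeiling_spec (hl : G.IsGaugeDirection l) (s : Bool) {z : ℂ}
    (hz : z ∈ G.graphComplement) :
    ∀ᶠ z' in 𝓝 z, 0 < sg s * (absc l z' - absc l z) → G.ceiling l z' = G.sideCeiling l s z := by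
  rw [sideCeiling, dif_pos (exists_sideCeiling hl s hz)]
  exact (exists_sideCeiling hl s hz).choose_spec

lemma sideCeiling_eq (hl : G.IsGaugeDirection l) {s : Bool} {z : ℂ} (hz : z ∈ G.graphComplement)
    {o : Option E}
    (h : ∀ᶠ z' in 𝓝 z, 0 < sg s * (absc l z' - absc l z) → G.ceiling l z' = o) :
    G.sideCeiling l s z = o := by
  obtain ⟨z', h1, h2, h3⟩ :=
    ((frequently_beside hl s z).and_eventually (h.and (sideCeiling_spec hl s hz))).exists
  rw [← h3 h1, h2 h1]

lemma eventually_sideCeiling_beside (hl : G.IsGaugeDirection l) (s s' : Bool) {z : ℂ}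
    (hz : z ∈ G.graphComplement) :
    ∀ᶠ z' in 𝓝 z, 0 < sg s * (absc l z' - absc l z) →
      G.sideCeiling l s' z' = G.sideCeiling l s z := by
  filter_upwards [eventually_eventually_nhds.2 (sideCeiling_spec hl s hz),
    eventually_faceAt_eq hz] with z' h hz' hs
  have hc : Continuous fun z' => sg s * (absc l z' - absc l z) := by fun_prop
  apply sideCeiling_eq hl hz'.1
  filter_upwards [h, (isOpen_lt continuous_const hc).mem_nhds hs] with z'' h1 h2 _ using h1 h2

lemma eventually_sideCeiling_vertical (hl : G.IsGaugeDirection l) (s : Bool) {z : ℂ}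
    (hz : z ∈ G.graphComplement) :
    ∀ᶠ z' in 𝓝 z, absc l z' = absc l z → G.sideCeiling l s z' = G.sideCeiling l s z := by
  filter_upwards [eventually_eventually_nhds.2 (sideCeiling_spec hl s hz),
    eventually_faceAt_eq hz] with z' h hz' hx
  apply sideCeiling_eq hl hz'.1
  rwa [hx]

lemma sideCeiling_eq_of_vertical (hl : G.IsGaugeDirection l) (s : Bool) {x y₁ y₂ : ℝ}
    (h : ∀ y ∈ Set.Icc y₁ y₂, pointAt l x y ∈ G.graphComplement) (h12 : y₁ ≤ y₂) :
    G.sideCeiling l s (pointAt l x y₁) = G.sideCeiling l s (pointAt l x y₂) := by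
  refine isPreconnected_Icc.induction₂
    (fun a b => G.sideCeiling l s (pointAt l x a) = G.sideCeiling l s (pointAt l x b))
    (fun a ha => ?_) (fun a b c _ _ _ => Eq.trans) (fun a b _ _ => Eq.symm)
    (Set.left_mem_Icc.2 h12) (Set.right_mem_Icc.2 h12)
  have hc : Continuous fun y => pointAt l x y := by fun_prop
  have := (hc.tendsto a).eventually (eventually_sideCeiling_vertical hl s (h a ha))
  filter_upwards [mem_nhdsWithin_of_mem_nhds this] with b hb
  rw [absc_pointAt hl.inward, absc_pointAt hl.inward] at hb
  exact (hb rfl).symm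

/-- Just below an inner point of an edge, the edge is the ceiling. -/
lemma eventually_ceiling_below (hl : G.IsGaugeDirection l) {e : E} {x : ℝ} (hx : G.Spans l e x) :
    ∀ᶠ z in 𝓝 (pointAt l x (G.ht l e x)), z.im < G.ht l e (absc l z) → G.ceiling l z = some e := by
  obtain ⟨ε, hε, hball⟩ := Metric.eventually_nhds_iff_ball.1 (eventually_near_edge hl hx)
  have hc : Continuous fun z => pointAt l (absc l z) (G.ht l e (absc l z)) := by fun_prop
  have h2 : ∀ᶠ z in 𝓝 (pointAt l x (G.ht l e x)),
      pointAt l (absc l z) (G.ht l e (absc l z)) ∈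
        Metric.ball (pointAt l x (G.ht l e x)) ε := by
    apply (Metric.isOpen_ball.preimage hc).mem_nhds
    simp [absc_pointAt hl.inward, hε]
  filter_upwards [Metric.ball_mem_nhds _ hε, h2] with z hz hz' hlt
  have hsp := (hball z hz).2.1
  refine ceiling_eq_some hl ⟨hsp, hlt⟩ fun f hf => ?_
  rcases eq_or_ne f e with rfl | hfe
  · exact le_rfl
  by_contra hle
  have hle := not_le.1 hle
  -- the point of `f` above `z` lies between two points of the ball
  have hq : pointAt l (absc l z) (G.ht l f (absc l z)) ∈
      Metric.ball (pointAt l x (G.ht l e x)) ε := by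
    refine (convex_ball (pointAt l x (G.ht l e x)) ε).segment_subset hz hz' ?_
    set d := G.ht l e (absc l z) - z.im with hd
    have hd0 : 0 < d := by rw [hd]; linarith
    have hab : (G.ht l e (absc l z) - G.ht l f (absc l z)) / d +
        (G.ht l f (absc l z) - z.im) / d = 1 := by
      rw [← add_div, div_eq_one_iff_eq hd0.ne']; rw [hd]; ring
    refine ⟨_, _, div_nonneg (by linarith) hd0.le, div_nonneg (by linarith [hf.2]) hd0.le, hab, ?_⟩
    apply ext_absc_im hl.inward
    · rw [absc_add, absc_smul, absc_smul, absc_pointAt hl.inward, absc_pointAt hl.inward, ← add_mul,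
        hab, one_mul]
    · simp only [Complex.add_im, Complex.real_smul, Complex.mul_im, Complex.ofReal_re,
        Complex.ofReal_im, zero_mul, add_zero, pointAt_im]
      field_simp
      rw [hd]; ring
  exact (hball _ hq).2.2 f hfe (pointAt_mem_edgeSeg hl hf.1)

lemma faceAt_eq_belowFace_sideCeiling (hl : G.IsGaugeDirection l) (s : Bool) {z : ℂ}
    (hz : z ∈ G.graphComplement) : G.belowFace l (G.sideCeiling l s z) = G.faceAt z := by
  obtain ⟨z', h1, h2, h3, h4⟩ := ((frequently_beside hl s z).and_eventually
    ((eventually_faceAt_eq hz).and ((sideCeiling_spec hl s hz).and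
      (eventually_generic (G := G) (l := l) z)))).exists
  rw [← h2.2, ← h3 h1, faceAt_eq_belowFace_ceiling hl h2.1 fun w => h4 s h1 _]

/-- A point just below the internal vertex `w`. -/
def underPoint (G : PlabicGraph n W E) (l : ℂ) (w : W) : ℂ :=
  pointAt l (G.vx l (Sum.inr w)) ((G.pos (Sum.inr w)).im + sg false *
    (eventually_isWindow (G := G) (l := l) (Sum.inr w)).exists.choose)

/-- Where the ceilings to the left and to the right of a point differ, the obstacle above it is an
internal vertex. -/
lemma sideCeiling_cases (hl : G.IsGaugeDirection l) {z : ℂ} (hz : z ∈ G.graphComplement) :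
    (∃ o, ∀ s, G.sideCeiling l s z = o) ∨
      ∃ w, G.vertexFace l false (Sum.inr w) = G.faceAt z ∧
        ∀ s, G.sideCeiling l s z = G.sideCeiling l s (G.underPoint l w) := by
  obtain ⟨x, hx⟩ : ∃ x, x = absc l z := ⟨_, rfl⟩
  obtain ⟨y, hy⟩ : ∃ y, y = z.im := ⟨_, rfl⟩
  obtain rfl : z = pointAt l x y := by rw [hx, hy, pointAt_absc_im hl.inward]
  clear hx hy
  have hy0 : 0 < y := (mem_graphComplement.1 hz).1
  have hcont : Continuous fun y => pointAt l x y := by fun_prop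
  set H := {y' | y ≤ y' ∧ pointAt l x y' ∉ G.graphComplement} with hH
  rcases H.eq_empty_or_nonempty with hemp | hne
  · left
    obtain ⟨M, hM⟩ := exists_isGraphBound G l
    have hall : ∀ y', y ≤ y' → pointAt l x y' ∈ G.graphComplement := by
      intro y' hy'
      by_contra h
      have : y' ∈ H := ⟨hy', h⟩
      simp [hemp] at this
    refine ⟨none, fun s => ?_⟩
    have hle : y ≤ max y M + 1 := by linarith [le_max_left y M]
    rw [sideCeiling_eq_of_vertical hl s (fun y' h => hall y' h.1) hle]
    apply sideCeiling_eq hl (hall _ hle)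
    have : ∀ᶠ z' in 𝓝 (pointAt l x (max y M + 1)), M < z'.im := by
      apply (isOpen_lt continuous_const Complex.continuous_im).mem_nhds
      show M < max y M + 1
      linarith [le_max_right y M]
    filter_upwards [this] with z' hz' _
    apply ceiling_eq_none
    ext e
    simp only [Set.mem_empty_iff_false, iff_false]
    rintro ⟨h1, h2⟩
    have := (hM.2 e _ (pointAt_mem_edgeSeg hl h1)).2
    rw [pointAt_im] at this
    linarith
  · have hclosed : IsClosed H :=
      isClosed_Ici.inter ((isOpen_graphComplement.isClosed_compl).preimage hcont)
    have hbdd : BddBelow H := ⟨y, fun _ h => h.1⟩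
    have hmem := hclosed.csInf_mem hne hbdd
    set y₀ := sInf H with hy₀
    have hlt : y < y₀ := lt_of_le_of_ne hmem.1 fun h => hmem.2 (h ▸ hz)
    have hbelow : ∀ y', y ≤ y' → y' < y₀ → pointAt l x y' ∈ G.graphComplement := by
      intro y' h1 h2
      by_contra h
      exact absurd (csInf_le hbdd ⟨h1, h⟩) (not_le.2 h2)
    obtain ⟨e, he⟩ : ∃ e, pointAt l x y₀ ∈ G.edgeSeg e := by
      by_contra! h
      exact hmem.2 (mem_graphComplement.2 ⟨hy0.trans hlt, h⟩)
    by_cases hv : ∃ v, pointAt l x y₀ = G.pos v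
    · right
      obtain ⟨v, hv⟩ := hv
      have hvx : G.vx l v = x := by rw [vx, ← hv, absc_pointAt hl.inward]
      have hvy : (G.pos v).im = y₀ := by rw [← hv, pointAt_im]
      rcases v with i | w
      · rw [G.boundary_im] at hvy; linarith
      have hwin := (eventually_isWindow (G := G) (l := l) (Sum.inr w)).exists.choose_spec
      refine ⟨w, ?_⟩
      unfold underPoint
      set η := (eventually_isWindow (G := G) (l := l) (Sum.inr w)).exists.choose
      -- a height above `y`, above the lower end of the window and below the vertex
      obtain ⟨y', hy'1, hy'2⟩ := exists_between (max_lt hlt (sub_lt_self y₀ hwin.pos))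
      have hyy : y < y' := (le_max_left _ _).trans_lt hy'1
      have hyη : y₀ - η < y' := (le_max_right _ _).trans_lt hy'1
      have hseg1 : ∀ y'' ∈ Set.Icc y y', pointAt l x y'' ∈ G.graphComplement :=
        fun y'' h => hbelow y'' h.1 (h.2.trans_lt hy'2)
      have hseg2 : ∀ y'' ∈ Set.Icc (y₀ + sg false * η) y',
          pointAt l x y'' ∈ G.graphComplement := by
        intro y'' h
        simp only [sg_false] at h
        have := hwin.mem hl (s := false) (Or.inr ⟨w, rfl⟩) (t := y₀ - y'') (by linarith [h.2])
          (by linarith [h.1])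
        simpa [hvx, hvy] using this
      have hle2 : y₀ + sg false * η ≤ y' := by simp only [sg_false]; linarith
      constructor
      · rw [← hwin.faceAt_eq_vertexFace hl (Or.inr ⟨w, rfl⟩), hvx, hvy,
          faceAt_eq_of_vertical hseg2 hle2, faceAt_eq_of_vertical hseg1 hyy.le]
      · intro s
        rw [hvx, hvy, sideCeiling_eq_of_vertical hl s hseg2 hle2,
          sideCeiling_eq_of_vertical hl s hseg1 hyy.le]
    · left
      have he' := (mem_edgeSeg hl).1 he
      rw [absc_pointAt hl.inward, pointAt_im] at he'
      have hne : ∀ s, G.vx l (G.nend l s e) ≠ x := by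
        intro s h
        apply hv
        refine ⟨G.nend l s e, ext_absc_im hl.inward ?_ ?_⟩
        · rw [absc_pointAt hl.inward, ← h]
        · rw [pointAt_im, he'.2, ← ht_nend hl, h]
      have hsp : G.Spans l e x :=
        ⟨lt_of_le_of_ne he'.1.1 (hne true), lt_of_le_of_ne he'.1.2 (hne false).symm⟩
      have hev := eventually_side hl false e x (P := fun z => ∀ᶠ z' in 𝓝 z, G.ceiling l z' = some e)
        (by
          filter_upwards [eventually_eventually_nhds.2 (eventually_ceiling_below hl hsp)]
            with z hz hlt
          simp only [sg_false] at hlt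
          have : ∀ᶠ z' in 𝓝 z, z'.im < G.ht l e (absc l z') :=
            (isOpen_lt Complex.continuous_im
              ((continuous_ht e).comp (continuous_absc l))).mem_nhds (by
                show z.im < G.ht l e (absc l z)
                linarith)
          filter_upwards [hz, this] with z' h1 h2 using h1 h2)
      obtain ⟨t, ht, ht0, ht1⟩ := (hev.and (Ioo_mem_nhdsGT (sub_pos.2 hlt))).exists
      rw [← he'.2] at ht
      simp only [sg_false] at ht
      refine ⟨some e, fun s => ?_⟩
      rw [sideCeiling_eq_of_vertical hl s (y₂ := y₀ + -1 * t)
        (fun y' h => hbelow y' h.1 (by linarith [h.2])) (by linarith)]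
      apply sideCeiling_eq hl (hbelow _ (by linarith) (by linarith))
      filter_upwards [ht] with z' h _ using h

lemma exists_generic_between {a b : ℝ} (h : a < b) : ∃ x ∈ Set.Ioo a b, ∀ v, G.vx l v ≠ x := by
  have hinf := (Set.Ioo_infinite h).sdiff (Set.finite_range (G.vx l))
  obtain ⟨x, hx, hx'⟩ := hinf.nonempty
  exact ⟨x, hx, fun v hv => hx' ⟨v, hv⟩⟩

lemma exists_generic_ceiling_eq (hl : G.IsGaugeDirection l) (o : Option E) :
    ∃ z ∈ G.graphComplement, (∀ v, G.vx l v ≠ absc l z) ∧ G.ceiling l z = o ∧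
      G.faceAt z = G.belowFace l o := by
  have : ∃ z ∈ G.graphComplement, (∀ v, G.vx l v ≠ absc l z) ∧ G.ceiling l z = o := by
    rcases o with _ | e
    · obtain ⟨M, hM⟩ := exists_isGraphBound G l
      obtain ⟨x, -, hx⟩ := exists_generic_between (G := G) (l := l) zero_lt_one
      refine ⟨pointAt l x M, (faceAt_high hM le_rfl).1, by rwa [absc_pointAt hl.inward], ?_⟩
      apply ceiling_eq_none
      ext e
      simp only [Set.mem_empty_iff_false, iff_false]
      rintro ⟨h1, h2⟩
      have := (hM.2 e _ (pointAt_mem_edgeSeg hl h1)).2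
      simp only [pointAt_im] at this h2
      linarith
    · obtain ⟨x, hx, hgen⟩ := exists_generic_between (G := G) (nend_lt hl e)
      obtain ⟨t, ⟨h1, -⟩, h2⟩ := ((eventually_sideFace hl false e hx).and
        (eventually_side hl false e x (P := fun z => G.ceiling l z = some e) (by
          filter_upwards [eventually_ceiling_below hl hx] with z hz hlt
          simp only [sg_false] at hlt
          exact hz (by linarith)))).exists
      exact ⟨_, h1, by rwa [absc_pointAt hl.inward], h2⟩
  obtain ⟨z, h1, h2, h3⟩ := this
  refine ⟨z, h1, h2, h3, ?_⟩
  rw [faceAt_eq_belowFace_ceiling hl h1 fun w => h2 _, h3]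

/-- Connectedness of a face: a function of its ceilings that does not change below the
internal vertices is constant. -/
lemma eq_of_balanced (hl : G.IsGaugeDirection l) {A : Type*} (φ : Option E → A) {Ω : Set ℂ}
    (hφ : ∀ w, G.vertexFace l false (Sum.inr w) = Ω →
      φ (G.sideCeiling l true (G.underPoint l w)) = φ (G.sideCeiling l false (G.underPoint l w)))
    {o o' : Option E} (ho : G.belowFace l o = Ω) (ho' : G.belowFace l o' = Ω) : φ o = φ o' := by
  obtain ⟨z, hz, hg, hc, hf⟩ := exists_generic_ceiling_eq hl o
  obtain ⟨z', hz', hg', hc', hf'⟩ := exists_generic_ceiling_eq hl o'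
  rw [ho] at hf
  rw [ho'] at hf'
  have hpre : IsPreconnected Ω := by
    rw [← hf]; exact isPreconnected_connectedComponentIn
  have hsub : Ω ⊆ G.graphComplement := by rw [← hf]; exact faceAt_subset z
  have hface : ∀ a ∈ Ω, G.faceAt a = Ω := by
    intro a ha; rw [← hf] at ha ⊢; exact faceAt_eq_of_mem ha
  have hlr : ∀ a ∈ Ω, ∀ s s', φ (G.sideCeiling l s a) = φ (G.sideCeiling l s' a) := by
    intro a ha
    have key : φ (G.sideCeiling l true a) = φ (G.sideCeiling l false a) := by
      rcases sideCeiling_cases hl (hsub ha) with ⟨o, ho⟩ | ⟨w, hw, hw'⟩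
      · rw [ho, ho]
      · rw [hw', hw']; exact hφ w (hw.trans (hface a ha))
    intro s s'
    cases s <;> cases s' <;> simp [key]
  have hconst := hpre.induction₂
    (fun a b => φ (G.sideCeiling l true a) = φ (G.sideCeiling l true b)) (fun a ha => by
      filter_upwards [mem_nhdsWithin_of_mem_nhds (eventually_sideCeiling_vertical hl true (hsub ha)),
        mem_nhdsWithin_of_mem_nhds (eventually_sideCeiling_beside hl true true (hsub ha)),
        mem_nhdsWithin_of_mem_nhds (eventually_sideCeiling_beside hl false true (hsub ha))]
        with b h1 h2 h3
      simp only [sg_true, sg_false] at h2 h3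
      rcases lt_trichotomy (absc l b) (absc l a) with h | h | h
      · rw [h3 (by linarith)]; exact hlr a ha _ _
      · rw [h1 h]
      · rw [h2 (by linarith)])
    (fun a b c _ _ _ => Eq.trans) (fun a b _ _ => Eq.symm)
    (hf ▸ mem_faceAt_self hz) (hf' ▸ mem_faceAt_self hz')
  have hcz : G.sideCeiling l true z = o :=
    sideCeiling_eq hl hz (by
      filter_upwards [eventually_ceiling_eq hl hz hg] with a ha _ using ha.trans hc)
  have hcz' : G.sideCeiling l true z' = o' :=
    sideCeiling_eq hl hz' (by
      filter_upwards [eventually_ceiling_eq hl hz' hg'] with a ha _ using ha.trans hc')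
  rw [← hcz, ← hcz']
  exact hconst

/-! ### Euler's formula -/

section
open Classical

/-- The inequality that expresses connectedness of a face: a function of its ceilings is determined
by one value and by its changes below the internal vertices. -/
lemma card_belowFace_le (hl : G.IsGaugeDirection l) (Ω : Set ℂ) :
    (Finset.univ.filter fun o => G.belowFace l o = Ω).card ≤
      (Finset.univ.filter fun w => G.vertexFace l false (Sum.inr w) = Ω).card + 1 := by
  rcases (Finset.univ.filter fun o => G.belowFace l o = Ω).eq_empty_or_nonempty with h | ⟨o₀, ho₀⟩
  · simp [h]
  replace ho₀ : G.belowFace l o₀ = Ω := by simpa using ho₀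
  have hmem : ∀ s (w : {w : W // G.vertexFace l false (Sum.inr w) = Ω}),
      G.belowFace l (G.sideCeiling l s (G.underPoint l w.1)) = Ω := by
    intro s w
    have hwin := (eventually_isWindow (G := G) (l := l) (Sum.inr w.1)).exists.choose_spec
    rw [underPoint, faceAt_eq_belowFace_sideCeiling hl s
      (hwin.mem hl (s := false) (Or.inr ⟨w.1, rfl⟩) hwin.pos le_rfl)]
    exact w.2
  let T : ({o : Option E // G.belowFace l o = Ω} → ℚ) →ₗ[ℚ]
      ({w : W // G.vertexFace l false (Sum.inr w) = Ω} → ℚ) × ℚ :=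
    { toFun := fun φ => (fun w => φ ⟨_, hmem true w⟩ - φ ⟨_, hmem false w⟩, φ ⟨o₀, ho₀⟩)
      map_add' := fun φ ψ => by ext <;> simp; ring
      map_smul' := fun c φ => by ext <;> simp; ring }
  have hT : Function.Injective T := by
    rw [injective_iff_map_eq_zero]
    intro φ hφ
    have h1 : ∀ w, φ ⟨_, hmem true w⟩ - φ ⟨_, hmem false w⟩ = 0 := congrFun (congrArg Prod.fst hφ)
    have h2 : φ ⟨o₀, ho₀⟩ = 0 := congrArg Prod.snd hφ
    ext ⟨o, ho⟩
    have := eq_of_balanced hl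
      (fun o => if h : G.belowFace l o = Ω then φ ⟨o, h⟩ else 0) (Ω := Ω)
      (fun w hw => by
        have := h1 ⟨w, hw⟩
        rw [dif_pos (hmem true ⟨w, hw⟩), dif_pos (hmem false ⟨w, hw⟩)]
        linarith) ho ho₀
    rw [dif_pos ho, dif_pos ho₀, h2] at this
    exact this
  have := LinearMap.finrank_le_finrank_of_injective hT
  simpa [Fintype.card_subtype] using this

/-- A function of the internal vertices, extended by zero to the boundary. -/
def extendVertex {A : Type*} [Zero A] (η : W → A) : Fin n ⊕ W → A := Sum.elim (fun _ => 0) η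

/-- The coboundary of a function of the internal vertices: the change from the left to the right
end of an edge. -/
def vertexDiff (G : PlabicGraph n W E) (l : ℂ) (η : W → ℚ) (e : E) : ℚ :=
  extendVertex η (G.nend l false e) - extendVertex η (G.nend l true e)

lemma sum_jump_mul_end (hl : G.IsGaugeDirection l) {R : Type*} [CommRing R] (f : Set ℂ → R)
    (η : W → R) (s : Bool) :
    ∑ e, G.jump l f e * extendVertex η (G.nend l s e) =
      ∑ w, (f (G.vertexFace l true (Sum.inr w)) - f (G.vertexFace l false (Sum.inr w))) * η w := by
  rw [← Finset.sum_fiberwise _ (fun e => G.nend l s e), Fintype.sum_sum_type]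
  have h1 : ∀ i : Fin n, ∑ e with G.nend l s e = Sum.inl i,
      G.jump l f e * extendVertex η (G.nend l s e) = 0 := by
    intro i
    refine Finset.sum_eq_zero fun e he => ?_
    rw [(Finset.mem_filter.1 he).2]
    simp [extendVertex]
  rw [Finset.sum_eq_zero fun i _ => h1 i, zero_add]
  refine Finset.sum_congr rfl fun w _ => ?_
  rw [← sum_jump_side hl f s w, Finset.sum_mul]
  refine Finset.sum_congr rfl fun e he => ?_
  rw [(Finset.mem_filter.1 he).2]
  rfl

/-- The jumps of a function of the faces are orthogonal to the coboundaries of functions of the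
internal vertices. -/
lemma sum_jump_mul_vertexDiff (hl : G.IsGaugeDirection l) (f : Set ℂ → ℚ) (η : W → ℚ) :
    ∑ e, G.jump l f e * G.vertexDiff l η e = 0 := by
  simp only [vertexDiff, mul_sub, Finset.sum_sub_distrib]
  rw [sum_jump_mul_end hl, sum_jump_mul_end hl, sub_self]

/-- This is where every vertex has to be joined to the boundary. -/
lemma eq_zero_of_vertexDiff_eq_zero (hl : G.IsGaugeDirection l) {η : W → ℚ}
    (h : ∀ e, G.vertexDiff l η e = 0) : η = 0 := by
  have hst : ∀ e, extendVertex η (G.src e) = extendVertex η (G.tgt e) := by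
    intro e
    have := h e
    rw [vertexDiff] at this
    rcases nend_cases hl e with ⟨-, h1, h2⟩ | ⟨-, h1, h2⟩ <;> rw [h1, h2] at this <;> linarith
  ext w
  obtain ⟨i, hi⟩ := G.connected (Sum.inr w)
  have : extendVertex η (Sum.inr w : Fin n ⊕ W) = extendVertex η (Sum.inl i : Fin n ⊕ W) := by
    generalize (Sum.inl i : Fin n ⊕ W) = v at hi
    induction hi with
    | refl => rfl
    | tail _ hstep ih =>
      obtain ⟨e, ⟨rfl, rfl⟩ | ⟨rfl, rfl⟩⟩ := hstep
      · rw [ih, hst]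
      · rw [ih, hst]
  exact this

lemma eq_topFace_of_jump_eq_zero (hl : G.IsGaugeDirection l) {f : Set ℂ → ℚ}
    (h : ∀ e, G.jump l f e = 0) (o : Option E) : f (G.belowFace l o) = f (G.topFace l) := by
  obtain ⟨z, hz, hg, -, hf⟩ := exists_generic_ceiling_eq hl o
  obtain ⟨M, hM⟩ := exists_isGraphBound G l
  have hh := faceAt_high hM (z := pointAt l (absc l z) (max z.im M)) (le_max_right _ _)
  have := sum_jump_crossed hl f (x := absc l z) (y₁ := z.im) (fun w => hg _)
    (mem_graphComplement.1 hz).1 (by rwa [pointAt_absc_im hl.inward]) hh.1 (le_max_left _ _)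
  rw [Finset.sum_eq_zero fun e _ => h e, hh.2, pointAt_absc_im hl.inward, hf] at this
  linarith

lemma IsFace.mem_range (hl : G.IsGaugeDirection l) {Ω : Set ℂ} (h : G.IsFace Ω) :
    Ω ∈ Set.range (G.belowFace l) := by
  obtain ⟨z, hz, rfl⟩ := h
  exact ⟨_, faceAt_eq_belowFace_sideCeiling hl true hz⟩

lemma vertexFace_mem_range (hl : G.IsGaugeDirection l) (s : Bool) (w : W) :
    G.vertexFace l s (Sum.inr w) ∈ Set.range (G.belowFace l) := by
  have hwin := (eventually_isWindow (G := G) (l := l) (Sum.inr w)).exists.choose_spec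
  rw [vertexFace]
  exact (isFace_faceAt (hwin.mem hl (Or.inr ⟨w, rfl⟩) hwin.pos le_rfl)).mem_range hl

/-- Functions of the faces and functions of the internal vertices jointly give functions of the
edges; the value at the face at infinity is recorded as well. -/
def edgeMap (G : PlabicGraph n W E) (l : ℂ) :
    ((Set.range (G.belowFace l) → ℚ) × (W → ℚ)) →ₗ[ℚ] (E → ℚ) × ℚ where
  toFun p := (fun e => G.jump l (Function.extend Subtype.val p.1 0) e + G.vertexDiff l p.2 e,
    p.1 ⟨G.topFace l, none, rfl⟩)
  map_add' p q := by
    have h1 : Function.extend Subtype.val (p.1 + q.1) (0 : Set ℂ → ℚ) =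
        Function.extend Subtype.val p.1 0 + Function.extend Subtype.val q.1 0 := by
      rw [← Function.extend_add, add_zero]
    have h2 : ∀ v : Fin n ⊕ W, extendVertex (p.2 + q.2) v =
        extendVertex p.2 v + extendVertex q.2 v := by
      rintro (i | w) <;> simp [extendVertex]
    ext
    · simp only [Prod.fst_add, Prod.snd_add, h1, jump, vertexDiff, h2, Pi.add_apply]; ring
    · rfl
  map_smul' c p := by
    have h1 : Function.extend Subtype.val (c • p.1) (0 : Set ℂ → ℚ) =
        c • Function.extend Subtype.val p.1 0 := by
      rw [← Function.extend_smul, smul_zero]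
    have h2 : ∀ v : Fin n ⊕ W, extendVertex (c • p.2) v = c * extendVertex p.2 v := by
      rintro (i | w) <;> simp [extendVertex]
    ext
    · simp only [Prod.smul_fst, Prod.smul_snd, h1, jump, vertexDiff, h2, Pi.smul_apply,
        smul_eq_mul, RingHom.id_apply]
      ring
    · rfl

lemma eq_zero_of_sum_mul_self {g : E → ℚ} (h : ∑ e, g e * g e = 0) (e : E) : g e = 0 := by
  have := (Finset.sum_eq_zero_iff_of_nonneg fun e _ => mul_self_nonneg (g e)).1 h e
    (Finset.mem_univ e)
  exact mul_self_eq_zero.1 this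

/-- The two kinds of functions of the edges are orthogonal, hence both parts of a vanishing sum
vanish. -/
lemma edgeMap_injective (hl : G.IsGaugeDirection l) : Function.Injective (G.edgeMap l) := by
  rw [injective_iff_map_eq_zero]
  rintro ⟨f, η⟩ h
  have h1 : ∀ e, G.jump l (Function.extend Subtype.val f 0) e + G.vertexDiff l η e = 0 :=
    congrFun (congrArg Prod.fst h)
  have h2 : f ⟨G.topFace l, none, rfl⟩ = 0 := congrArg Prod.snd h
  have hd : ∀ e, G.vertexDiff l η e = 0 := by
    apply eq_zero_of_sum_mul_self
    rw [← neg_eq_zero, ← Finset.sum_neg_distrib,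
      ← sum_jump_mul_vertexDiff hl (Function.extend Subtype.val f 0) η]
    refine Finset.sum_congr rfl fun e _ => ?_
    linear_combination (-G.vertexDiff l η e) * h1 e
  have hj : ∀ e, G.jump l (Function.extend Subtype.val f 0) e = 0 := by
    intro e
    have := h1 e
    rwa [hd e, add_zero] at this
  have hη := eq_zero_of_vertexDiff_eq_zero hl hd
  refine Prod.ext ?_ hη
  ext ⟨_, o, rfl⟩
  have := eq_topFace_of_jump_eq_zero hl hj o
  rw [Subtype.val_injective.extend_apply f 0 ⟨G.belowFace l o, o, rfl⟩,
    Subtype.val_injective.extend_apply f 0 ⟨G.topFace l, none, rfl⟩, h2] at this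
  exact this

/-- The inequality in Euler's formula that expresses that the graph is joined to the boundary. -/
lemma card_faces_add_card_le (hl : G.IsGaugeDirection l) :
    Fintype.card (Set.range (G.belowFace l)) + Fintype.card W ≤ Fintype.card E + 1 := by
  have := LinearMap.finrank_le_finrank_of_injective (edgeMap_injective hl)
  simpa using this

lemma sum_card_belowFace :
    ∑ Ω : Set.range (G.belowFace l), (Finset.univ.filter fun o => G.belowFace l o = Ω.1).card =
      Fintype.card E + 1 := by
  rw [← Fintype.card_option, ← Finset.card_univ,
    Finset.card_eq_sum_card_fiberwise (f := Set.rangeFactorization (G.belowFace l))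
      (t := Finset.univ) (fun _ _ => Finset.mem_coe.2 (Finset.mem_univ _))]
  simp [Set.rangeFactorization, Subtype.ext_iff]

lemma sum_card_vertexFace (hl : G.IsGaugeDirection l) :
    ∑ Ω : Set.range (G.belowFace l),
      (Finset.univ.filter fun w => G.vertexFace l false (Sum.inr w) = Ω.1).card =
      Fintype.card W := by
  rw [← Finset.card_univ,
    Finset.card_eq_sum_card_fiberwise
      (f := fun w => (⟨_, vertexFace_mem_range hl false w⟩ : Set.range (G.belowFace l)))
      (t := Finset.univ) (fun _ _ => Finset.mem_coe.2 (Finset.mem_univ _))]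
  simp [Subtype.ext_iff]

/-- Euler's formula: the inequalities `card_faces_add_card_le` and, summed over the faces,
`card_belowFace_le` are opposite to each other. -/
lemma card_faces_add_card (hl : G.IsGaugeDirection l) :
    Fintype.card (Set.range (G.belowFace l)) + Fintype.card W = Fintype.card E + 1 := by
  refine le_antisymm (card_faces_add_card_le hl) ?_
  rw [← sum_card_belowFace (G := G) (l := l), ← sum_card_vertexFace hl, add_comm,
    ← Finset.card_univ, Finset.card_eq_sum_ones, ← Finset.sum_add_distrib]
  exact Finset.sum_le_sum fun Ω _ => card_belowFace_le hl Ω.1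

/-- Euler's formula for one face, saying that the face is simply connected: the top face counts
`none` among the ceilings. -/
lemma card_belowFace_eq (hl : G.IsGaugeDirection l) {Ω : Set ℂ} (hΩ : G.IsFace Ω) :
    (Finset.univ.filter fun o => G.belowFace l o = Ω).card =
      (Finset.univ.filter fun w => G.vertexFace l false (Sum.inr w) = Ω).card + 1 := by
  have hsum : ∑ Ω : Set.range (G.belowFace l),
      (Finset.univ.filter fun o => G.belowFace l o = Ω.1).card =
      ∑ Ω : Set.range (G.belowFace l),
        ((Finset.univ.filter fun w => G.vertexFace l false (Sum.inr w) = Ω.1).card + 1) := by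
    rw [sum_card_belowFace, Finset.sum_add_distrib, sum_card_vertexFace hl, ← card_faces_add_card hl,
      ← Finset.card_eq_sum_ones, Finset.card_univ, add_comm]
  exact (Finset.sum_eq_sum_iff_of_le fun Ω _ => card_belowFace_le hl Ω.1).1 hsum
    ⟨Ω, hΩ.mem_range hl⟩ (Finset.mem_univ _)

lemma edgeMap_surjective (hl : G.IsGaugeDirection l) : Function.Surjective (G.edgeMap l) := by
  refine (LinearMap.injective_iff_surjective_of_finrank_eq_finrank ?_).1 (edgeMap_injective hl)
  simpa using card_faces_add_card hl

/-- An edge with the same face on both sides is an isthmus: it alone carries the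
coboundary of a function of the vertices. Indeed the jump part of the decomposition of its
indicator given by `edgeMap_surjective` is orthogonal to itself. -/
lemma exists_vertexDiff_eq_single (hl : G.IsGaugeDirection l) {e : E}
    (h : G.sideFace l true e = G.sideFace l false e) :
    ∃ η : W → ℚ, ∀ a, G.vertexDiff l η a = if a = e then 1 else 0 := by
  obtain ⟨⟨f, η⟩, hp⟩ := edgeMap_surjective hl (fun a => if a = e then 1 else 0, 0)
  have h1 : ∀ a, G.jump l (Function.extend Subtype.val f 0) a + G.vertexDiff l η a =
    if a = e then 1 else 0 := congrFun (congrArg Prod.fst hp)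
  set F := Function.extend Subtype.val f (0 : Set ℂ → ℚ)
  have he : G.jump l F e = 0 := by rw [jump, h, sub_self]
  have hj : ∀ a, G.jump l F a = 0 := by
    apply eq_zero_of_sum_mul_self
    have h2 : ∀ a, G.jump l F a * G.jump l F a = - (G.jump l F a * G.vertexDiff l η a) := by
      intro a
      have := h1 a
      split_ifs at this with ha
      · subst ha; rw [he]; ring
      · linear_combination (G.jump l F a) * this
    rw [Finset.sum_congr rfl fun a _ => h2 a, Finset.sum_neg_distrib,
      sum_jump_mul_vertexDiff hl, neg_zero]
  refine ⟨η, fun a => ?_⟩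
  rw [← h1 a, hj a, zero_add]

/-- In a PBDTP graph the two sides of an edge belong to different faces: along a directed path
from the boundary to the boundary, the function attached to an isthmus would change
monotonically, by a nonzero amount. -/
lemma sideFace_ne (hG : G.IsPBDTP) (hl : G.IsGaugeDirection l) (e : E) :
    G.sideFace l true e ≠ G.sideFace l false e := by
  intro h
  obtain ⟨η, hη⟩ := exists_vertexDiff_eq_single hl h
  obtain ⟨e₀, e₁, ⟨i, hi⟩, ⟨j, hj⟩, h0, h1⟩ := hG e
  -- the sign `c` tells whether `e` is directed to the right or to the left
  obtain ⟨c, hc⟩ : ∃ c : ℚ, ∀ a, 0 ≤ c * extendVertex η (G.tgt a) - c * extendVertex η (G.src a) ∧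
      (a = e → 0 < c * extendVertex η (G.tgt a) - c * extendVertex η (G.src a)) := by
    have hne : ∀ a, a ≠ e → extendVertex η (G.tgt a) = extendVertex η (G.src a) := by
      intro a ha
      have := hη a
      rw [if_neg ha, vertexDiff] at this
      rcases nend_cases hl a with ⟨-, h1, h2⟩ | ⟨-, h1, h2⟩ <;> rw [h1, h2] at this <;> linarith
    have hse := hη e
    rw [if_pos rfl, vertexDiff] at hse
    rcases nend_cases hl e with ⟨-, h1, h2⟩ | ⟨-, h1, h2⟩ <;> rw [h1, h2] at hse
    · refine ⟨1, fun a => ?_⟩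
      by_cases ha : a = e
      · subst ha; constructor <;> intros <;> linarith
      · rw [hne a ha]; simp [ha]
    · refine ⟨-1, fun a => ?_⟩
      by_cases ha : a = e
      · subst ha; constructor <;> intros <;> linarith
      · rw [hne a ha]; simp [ha]
  have hsrc : ∀ a, Relation.ReflTransGen G.Follows e₀ a → 0 ≤ c * extendVertex η (G.src a) := by
    intro a ha
    induction ha with
    | refl => rw [hi]; simp [extendVertex]
    | @tail a b _ hstep ih =>
      rw [Follows] at hstep
      rw [← hstep]
      linarith [(hc a).1]
  have htgt : ∀ a, Relation.ReflTransGen G.Follows e a → 0 < c * extendVertex η (G.tgt a) := by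
    intro a ha
    induction ha with
    | refl => linarith [hsrc e h0, (hc e).2 rfl]
    | @tail a b _ hstep ih =>
      rw [Follows] at hstep
      rw [hstep] at ih
      linarith [(hc b).1]
  have := htgt e₁ h1
  rw [hj] at this
  simp [extendVertex] at this

end

/-! ### Boundaries of faces -/

section
open Classical

/-- The indicator of `Ω` among the faces, with values mod 2. -/
def faceInd (Ω A : Set ℂ) : ZMod 2 := if A = Ω then 1 else 0

lemma faceInd_eq_one {Ω A : Set ℂ} : faceInd Ω A = 1 ↔ A = Ω := by
  unfold faceInd; split_ifs with h <;> simp [h]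

lemma mem_frontier_of_mem_closure {Ω : Set ℂ} (hΩ : G.IsFace Ω) {p : ℂ} (hp : p ∈ closure Ω)
    (hpC : p ∉ G.graphComplement) : p ∈ frontier Ω := by
  obtain ⟨z, -, rfl⟩ := hΩ
  exact ⟨hp, fun h => hpC (faceAt_subset z (interior_subset h))⟩

lemma edgeSeg_subset_frontier_iff (hl : G.IsGaugeDirection l) {Ω : Set ℂ} (hΩ : G.IsFace Ω)
    (e : E) : G.edgeSeg e ⊆ frontier Ω ↔
      G.sideFace l true e = Ω ∨ G.sideFace l false e = Ω := by
  constructor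
  · intro h
    obtain ⟨x, hx⟩ : ∃ x, G.Spans l e x := exists_between (nend_lt hl e)
    have hcl := frontier_subset_closure (h (pointAt_mem_edgeSeg hl hx))
    have hev := (sideFace_spec hl true e hx).and (sideFace_spec hl false e hx)
    have hsp : ∀ᶠ z in 𝓝 (pointAt l x (G.ht l e x)), G.Spans l e (absc l z) :=
      (eventually_near_edge hl hx).mono fun _ h => h.2.1
    obtain ⟨z, ⟨hzΩ, h1, h2⟩, h3⟩ :=
      (((mem_closure_iff_frequently.1 hcl).and_eventually hev).and_eventually hsp).exists
    have hzf := hΩ.eq_faceAt hzΩ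
    have hzC : z ∈ G.graphComplement := by
      obtain ⟨z₀, -, rfl⟩ := hΩ
      exact faceAt_subset z₀ hzΩ
    simp only [sg_true, sg_false] at h1 h2
    rcases lt_trichotomy z.im (G.ht l e (absc l z)) with hlt | heq | hgt
    · right; rw [hzf]; exact (h2 (by linarith)).2.symm
    · exact absurd ((mem_edgeSeg hl).2 ⟨⟨h3.1.le, h3.2.le⟩, heq⟩) ((mem_graphComplement.1 hzC).2 e)
    · left; rw [hzf]; exact (h1 (by linarith)).2.symm
  · intro h
    obtain ⟨s, hs⟩ : ∃ s, G.sideFace l s e = Ω := by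
      rcases h with h | h
      · exact ⟨_, h⟩
      · exact ⟨_, h⟩
    have hin : ∀ x, G.Spans l e x → pointAt l x (G.ht l e x) ∈ closure Ω := by
      intro x hx
      refine mem_closure_of_tendsto (tendsto_pointAt_add (l := l) s x (G.ht l e x)) ?_
      filter_upwards [eventually_sideFace hl s e hx] with t ht
      rw [← hs, ← ht.2]
      exact mem_faceAt_self ht.1
    intro p hp
    refine mem_frontier_of_mem_closure hΩ ?_ fun h => (mem_graphComplement.1 h).2 e hp
    have hp' := (mem_edgeSeg hl).1 hp
    have hcont : Continuous fun x => pointAt l x (G.ht l e x) := by fun_prop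
    have hcl : absc l p ∈ closure {x | G.Spans l e x} := by
      change absc l p ∈ closure (Set.Ioo _ _)
      rw [closure_Ioo (nend_lt hl e).ne]
      exact hp'.1
    have := map_mem_closure hcont hcl (t := closure Ω) hin
    rwa [closure_closure, ← hp'.2, pointAt_absc_im hl.inward] at this

lemma exists_edge_at (w : W) : ∃ e, G.src e = Sum.inr w ∨ G.tgt e = Sum.inr w := by
  have : {e | G.src e = Sum.inr w ∨ G.tgt e = Sum.inr w}.Nonempty := by
    apply Set.nonempty_of_ncard_ne_zero
    rcases G.internal_degree w with h | h <;> omega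
  exact this

lemma pos_notMem_graphComplement (w : W) : G.pos (Sum.inr w) ∉ G.graphComplement := by
  intro h
  obtain ⟨e, he | he⟩ := exists_edge_at (G := G) w
  · exact (mem_graphComplement.1 h).2 e (he ▸ left_mem_segment _ _ _)
  · exact (mem_graphComplement.1 h).2 e (he ▸ right_mem_segment _ _ _)

lemma mem_frontier_iff (hl : G.IsGaugeDirection l) {Ω : Set ℂ} (hΩ : G.IsFace Ω) (w : W) :
    G.pos (Sum.inr w) ∈ frontier Ω ↔ G.vertexFace l true (Sum.inr w) = Ω ∨
      ∃ s e, G.nend l s e = Sum.inr w ∧ G.sideFace l false e = Ω := by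
  constructor
  · intro h
    have hfr := (mem_closure_iff_frequently.1 (frontier_subset_closure h)).and_eventually
      (eventually_eventually_nhds.2 (eventually_faceAt_near_vertex hl w))
    obtain ⟨z, hz, hz'⟩ := hfr.exists
    have hopen : IsOpen Ω := by
      obtain ⟨z₀, -, rfl⟩ := hΩ
      exact isOpen_faceAt z₀
    have hev : ∀ᶠ a in 𝓝 z, a ∈ Ω := hopen.mem_nhds hz
    -- the face is open, hence contains points off the vertical line through the vertex
    obtain ⟨z', hz1, hz2, hz3, hz4⟩ := ((frequently_beside hl true z).and_eventually
      (hz'.and (hev.and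
        (eventually_generic (G := G) (l := l) z)))).exists
    have hC : z' ∈ G.graphComplement := by
      obtain ⟨z₀, -, rfl⟩ := hΩ
      exact faceAt_subset z₀ hz3
    rw [hΩ.eq_faceAt hz3]
    rcases hz2 hC (hz4 true hz1 _).symm with h | ⟨e, s, h1, h2⟩
    · exact Or.inl h.symm
    · exact Or.inr ⟨s, e, h1, h2.symm⟩
  · rintro (h | ⟨s, e, h1, h2⟩)
    · refine mem_frontier_of_mem_closure hΩ ?_ (pos_notMem_graphComplement w)
      have ht := tendsto_pointAt_add (l := l) true (G.vx l (Sum.inr w)) (G.pos (Sum.inr w)).im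
      rw [pointAt_absc_im hl.inward] at ht
      refine mem_closure_of_tendsto ht ?_
      filter_upwards [eventually_isWindow (G := G) (l := l) (Sum.inr w)] with t hwin
      rw [← h, ← hwin.faceAt_eq_vertexFace hl (Or.inl rfl)]
      exact mem_faceAt_self (hwin.mem hl (Or.inl rfl) hwin.pos le_rfl)
    · rw [← h1]
      exact (edgeSeg_subset_frontier_iff hl hΩ e).2 (Or.inr h2) (pos_nend_mem s e)

/-- Since the two sides of an edge are different faces, the edges bounding `Ω` are those across which
the indicator of `Ω` jumps. -/
lemma jump_faceInd (hG : G.IsPBDTP) (hl : G.IsGaugeDirection l) {Ω : Set ℂ} (hΩ : G.IsFace Ω)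
    (e : E) : G.jump l (faceInd Ω) e = if G.edgeSeg e ⊆ frontier Ω then 1 else 0 := by
  have hne := sideFace_ne hG hl e
  rw [edgeSeg_subset_frontier_iff hl hΩ, jump, faceInd, faceInd]
  by_cases h1 : G.sideFace l true e = Ω <;> by_cases h2 : G.sideFace l false e = Ω
  · exact absurd (h1.trans h2.symm) hne
  · simp [h1, h2]
  · simp [h1, h2]
  · simp [h1, h2]

lemma faceSignature_eq (hG : G.IsPBDTP) (hl : G.IsGaugeDirection l) {Ω : Set ℂ}
    (hΩ : G.IsFace Ω) (ε : E → ZMod 2) :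
    G.faceSignature ε Ω = ∑ e, G.jump l (faceInd Ω) e * ε e := by
  rw [faceSignature, Finset.sum_filter]
  refine Finset.sum_congr rfl fun e _ => ?_
  rw [jump_faceInd hG hl hΩ]
  split_ifs <;> simp

/-! ### The gauge rays -/

lemma IsGaugeDirection.isClean (hl : G.IsGaugeDirection l) (i : Fin n) :
    G.IsClean l (G.vx l (Sum.inl i)) := by
  intro w hw
  have hne := hl.inward.ne'
  refine hl.avoids i w ⟨(G.pos (Sum.inr w)).im / l.im, div_pos (G.internal_im w) hl.inward, ?_⟩
  apply ext_absc_im hl.inward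
  · rw [absc_add, absc_mul_self, add_zero]; exact hw
  · simp [G.boundary_im, hne]

lemma gaugeRay_inter_nonempty_iff (hl : G.IsGaugeDirection l) (i : Fin n) (e : E) :
    (G.gaugeRay l i ∩ G.edgeSeg e).Nonempty ↔ G.Spans l e (G.vx l (Sum.inl i)) := by
  constructor
  · rintro ⟨z, ⟨t, ht, rfl⟩, hz⟩
    rw [mem_edgeSeg hl, absc_add, absc_mul_self, add_zero] at hz
    have hne : ∀ s, G.vx l (G.nend l s e) ≠ G.vx l (Sum.inl i) := by
      intro s hs
      rcases hv : G.nend l s e with j | w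
      · have h1 := hz.2
        rw [← vx, ← hs, ht_nend hl, hv, G.boundary_im] at h1
        simp only [Complex.add_im, Complex.im_ofReal_mul,
          G.boundary_im] at h1
        have := mul_pos ht hl.inward
        linarith
      · rw [hv] at hs
        exact hl.isClean i w hs
    exact ⟨lt_of_le_of_ne hz.1.1 (hne true), lt_of_le_of_ne hz.1.2 (hne false).symm⟩
  · intro h
    refine ⟨_, ⟨G.ht l e (G.vx l (Sum.inl i)) / l.im,
      div_pos (ht_pos_of_spans hl h) hl.inward, ?_⟩, pointAt_mem_edgeSeg hl h⟩
    have hne := hl.inward.ne'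
    apply ext_absc_im hl.inward
    · rw [absc_add, absc_mul_self, add_zero, absc_pointAt hl.inward]
    · simp [G.boundary_im, hne]

lemma sign_cast_eq_one {x : ℝ} (hx : x ≠ 0) : (((SignType.sign x : SignType) : ℤ) : ZMod 2) = 1 := by
  rcases lt_or_gt_of_ne hx with h | h
  · rw [sign_neg h]; decide
  · rw [sign_pos h]; decide

lemma intNumber_cast (hl : G.IsGaugeDirection l) (e : E) :
    (G.intNumber l e : ZMod 2) =
      ∑ i with G.IsSource i, if G.Spans l e (G.vx l (Sum.inl i)) then 1 else 0 := by
  rw [intNumber, Int.cast_mul, orientIndex, sign_cast_eq_one (hl.not_parallel e), mul_one]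
  simp only [gaugeRay_inter_nonempty_iff hl, Int.cast_natCast]
  rw [Finset.sum_ite, Finset.sum_const_zero, add_zero, Finset.sum_const, nsmul_one,
    Set.ncard_eq_toFinset_card', Finset.filter_filter]
  congr 2
  ext; simp

/-- A gauge ray leads from the face just above its starting point to the top face. -/
lemma sum_jump_ray (hl : G.IsGaugeDirection l) {A : Type*} [AddCommGroup A] (f : Set ℂ → A)
    (i : Fin n) : ∑ e with G.Spans l e (G.vx l (Sum.inl i)), G.jump l f e =
      f (G.topFace l) - f (G.vertexFace l true (Sum.inl i)) := by
  obtain ⟨M, hM⟩ := exists_isGraphBound G l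
  obtain ⟨η, hwin, hη0, hηM⟩ := ((eventually_isWindow (G := G) (l := l) (Sum.inl i)).and
    (Ioo_mem_nhdsGT hM.1)).exists
  have h1 := hwin.mem hl (s := true) (Or.inl rfl) hwin.pos le_rfl
  have h2 := hwin.faceAt_eq_vertexFace hl (s := true) (Or.inl rfl)
  rw [G.boundary_im, sg_true, zero_add, one_mul] at h1 h2
  have h3 := faceAt_high hM (z := pointAt l (G.vx l (Sum.inl i)) M) le_rfl
  rw [← h2, ← h3.2, ← sum_jump_crossed hl f (hl.isClean i) hη0 h1 h3.1 hηM.le]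
  congr 1
  ext e
  simp only [Finset.mem_filter, Finset.mem_univ, true_and]
  refine ⟨fun h => ⟨h, ?_, (hM.2 e _ (pointAt_mem_edgeSeg hl h)).2⟩, fun h => h.1⟩
  have hp := ht_pos_of_spans hl h
  by_contra hle
  have := hwin.ht_eq e (by rw [G.boundary_im, sub_zero, abs_of_pos hp]; exact not_lt.1 hle)
  rw [G.boundary_im] at this
  linarith

/-! ### The winding of consecutive edges -/

lemma planeDet_left (l b : ℂ) : planeDet l b = - absc l b := by
  simp only [absc, planeDet]; ring

lemma planeDet_dir_mul_im (hl : G.IsGaugeDirection l) (a b : E) :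
    planeDet (G.dir a) (G.dir b) * l.im =
      absc l (G.dir a) * absc l (G.dir b) * (G.slope l b - G.slope l a) := by
  have h1 := hl.absc_dir_ne a
  have h2 := hl.absc_dir_ne b
  rw [planeDet_mul_im, slope, slope]
  field_simp

/-- The winding of two consecutive edges is odd exactly when both leave their common vertex
to the same side, the second one above the first one. -/
lemma localWind_cast (hl : G.IsGaugeDirection l) {a b : E} (h : G.tgt a = G.src b) :
    (localWind l (G.dir a) (G.dir b) : ZMod 2) =
      if ∃ s, G.nend l s a = G.src b ∧ G.nend l s b = G.src b ∧
        sg s * G.slope l a < sg s * G.slope l b then 1 else 0 := by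
  have hdet := planeDet_dir_mul_im hl a b
  have hna := G.src_ne_tgt a
  have hnb := G.src_ne_tgt b
  have hnb' := hnb.symm
  rw [h] at hna
  have hal : planeDet (G.dir a) l = absc l (G.dir a) := rfl
  have hbl : planeDet l (G.dir b) = - absc l (G.dir b) := planeDet_left _ _
  simp only [localWind, orientIndex, hal, hbl, Bool.exists_bool]
  have hl0 := hl.inward
  rcases nend_cases hl a with ⟨ha, ha1, ha2⟩ | ⟨ha, ha1, ha2⟩ <;>
    rcases nend_cases hl b with ⟨hb, hb1, hb2⟩ | ⟨hb, hb1, hb2⟩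
  · simp [ha1, hb2, hna, hnb', sign_pos ha, sign_neg (neg_lt_zero.2 hb)]
  · rcases lt_trichotomy (planeDet (G.dir a) (G.dir b)) 0 with hd | hd | hd
    · have : ¬ G.slope l b < G.slope l a := by
        intro hlt
        have := mul_neg_of_neg_of_pos hd hl0
        have := mul_pos (neg_pos.2 (mul_neg_of_pos_of_neg ha hb)) (sub_pos.2 hlt)
        linarith
      simp [ha1, ha2, hb1, hb2, h, hna, hnb', sign_pos ha, sign_pos (neg_pos.2 hb), sign_neg hd,
        this]
    · have : ¬ G.slope l b < G.slope l a := by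
        intro hlt
        rw [hd] at hdet
        have := mul_pos (neg_pos.2 (mul_neg_of_pos_of_neg ha hb)) (sub_pos.2 hlt)
        linarith
      simp [ha1, ha2, hb1, hb2, h, hna, hnb', sign_pos ha, sign_pos (neg_pos.2 hb), hd, this]
    · have : G.slope l b < G.slope l a := by
        by_contra hle
        have := mul_pos hd hl0
        have := mul_nonneg (neg_pos.2 (mul_neg_of_pos_of_neg ha hb)).le (sub_nonneg.2 (not_lt.1 hle))
        linarith
      simp [ha1, ha2, hb1, hb2, h, hna, hnb', sign_pos ha, sign_pos (neg_pos.2 hb), sign_pos hd,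
        this]
  · rcases lt_trichotomy (planeDet (G.dir a) (G.dir b)) 0 with hd | hd | hd
    · have : G.slope l a < G.slope l b := by
        by_contra hle
        have := mul_neg_of_neg_of_pos hd hl0
        have := mul_nonneg (neg_pos.2 (mul_neg_of_neg_of_pos ha hb)).le (sub_nonneg.2 (not_lt.1 hle))
        linarith
      simp [ha1, ha2, hb1, hb2, h, hna, hnb', sign_neg ha, sign_neg (neg_lt_zero.2 hb),
        sign_neg hd, this]
    · have : ¬ G.slope l a < G.slope l b := by
        intro hlt
        rw [hd] at hdet
        have := mul_pos (neg_pos.2 (mul_neg_of_neg_of_pos ha hb)) (sub_pos.2 hlt)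
        linarith
      simp [ha1, ha2, hb1, hb2, h, hna, hnb', sign_neg ha, sign_neg (neg_lt_zero.2 hb), hd, this]
    · have : ¬ G.slope l a < G.slope l b := by
        intro hlt
        have := mul_pos hd hl0
        have := mul_pos (neg_pos.2 (mul_neg_of_neg_of_pos ha hb)) (sub_pos.2 hlt)
        linarith
      simp [ha1, ha2, hb1, hb2, h, hna, hnb', sign_neg ha, sign_neg (neg_lt_zero.2 hb),
        sign_pos hd, this]
  · simp [ha2, hb1, hna, hnb', sign_neg ha, sign_pos (neg_pos.2 hb)]

end

/-! ### The corners at an internal vertex -/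

/-- What is needed, mod 2, of the corners on one side of an internal vertex, according to the number
of half-edges on this side: `d` and `u` tell whether `Ω` is the face just below and just above the vertex, `b` is the number of edges
on this side with `Ω` just below them, and `Q` says that there is such an edge. The parameters `q`
and `r` belong to the sectors between consecutive edges, from bottom to top; the vanishing products
say that sectors separated by one edge are different faces. -/
inductive SideCorners (d u b : ZMod 2) (Q : Prop) : ℕ → Prop
  | zero : b = 0 → u = d → ¬ Q → SideCorners d u b Q 0
  | one : b = d → d * u = 0 → (Q ↔ d = 1) → SideCorners d u b Q 1
  | two (q : ZMod 2) : b = d + q → d * q = 0 → q * u = 0 → (Q ↔ d = 1 ∨ q = 1) →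
      SideCorners d u b Q 2
  | three (q r : ZMod 2) : b = d + q + r → d * q = 0 → q * r = 0 → r * u = 0 →
      (Q ↔ d = 1 ∨ q = 1 ∨ r = 1) → SideCorners d u b Q 3

set_option synthInstance.maxSize 1000 in
/-- At a vertex of degree two or three any two sectors are adjacent, so that at most one of them
belongs to `Ω`. -/
lemma SideCorners.add_eq (d u b b' z : ZMod 2) {Q Q' : Prop} {k k' : ℕ}
    (h : SideCorners d u b Q k) (h' : SideCorners d u b' Q' k') (hk : k + k' = 2 ∨ k + k' = 3)
    (hz : z = 1 ↔ u = 1 ∨ Q' ∨ Q) : b + b' + u + d = z := by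
  cases h with
  | zero h1 h2 h3 =>
    cases h' with
    | zero => omega
    | one => omega
    | two q g1 g2 g3 g4 =>
      simp only [h3, g4, or_false] at hz; subst h1 h2 g1
      clear h3 g4; revert hz g2 g3; revert u q z; decide
    | three q r g1 g2 g3 g4 g5 =>
      simp only [h3, g5, or_false] at hz; subst h1 h2 g1
      clear h3 g5; revert hz g2 g3 g4; revert u q r z; decide
  | one h1 h2 h3 =>
    cases h' with
    | zero => omega
    | one g1 g2 g3 =>
      simp only [h3, g3] at hz; subst h1 g1
      clear h3 g3; revert hz h2; revert b' u z; decide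
    | two q g1 g2 g3 g4 =>
      simp only [h3, g4] at hz; subst h1 g1
      clear h3 g4; revert hz h2 g2 g3; revert b u q z; decide
    | three => omega
  | two q h1 h2 h3 h4 =>
    cases h' with
    | zero g1 g2 g3 =>
      simp only [g3, h4, false_or] at hz; subst h1 g1 g2
      clear h4 g3; revert hz h2 h3; revert u q z; decide
    | one g1 g2 g3 =>
      simp only [h4, g3] at hz; subst h1 g1
      clear h4 g3; revert hz h2 h3 g2; revert b' u q z; decide
    | two => omega
    | three => omega
  | three q r h1 h2 h3 h4 h5 =>
    cases h' with
    | zero g1 g2 g3 =>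
      simp only [g3, h5, false_or] at hz; subst h1 g1 g2
      clear h5 g3; revert hz h2 h3 h4; revert u q r z; decide
    | one => omega
    | two => omega
    | three => omega

section
open Classical

section
variable {A : Type*} [AddCommGroup A] (f : Set ℂ → A)

/-- The highest edge on one side of a vertex. Faces are compared through a function `f` of them. -/
lemma sideFace_true_of_max (hl : G.IsGaugeDirection l) {s : Bool} {v : Fin n ⊕ W} {e : E}
    (he : G.nend l s e = v)
    (hmax : ∀ e', G.nend l s e' = v → ¬ sg s * G.slope l e < sg s * G.slope l e') :
    f (G.sideFace l true e) = f (G.vertexFace l true v) := by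
  have := sum_jump_above hl f s he
  rw [Finset.filter_false_of_mem fun e' _ h => hmax e' h.1 h.2, Finset.sum_empty] at this
  exact (sub_eq_zero.1 this.symm).symm

lemma sideFace_false_of_min (hl : G.IsGaugeDirection l) {s : Bool} {w : W} {e : E}
    (he : G.nend l s e = Sum.inr w)
    (hmin : ∀ e', G.nend l s e' = Sum.inr w → ¬ sg s * G.slope l e' < sg s * G.slope l e) :
    f (G.sideFace l false e) = f (G.vertexFace l false (Sum.inr w)) := by
  have := sum_jump_below hl f s he
  rw [Finset.filter_false_of_mem fun e' _ h => hmin e' h.1 h.2, Finset.sum_empty] at this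
  exact sub_eq_zero.1 this.symm

lemma sideFace_false_of_succ (hl : G.IsGaugeDirection l) {s : Bool} {w : W} {e e' : E}
    (he : G.nend l s e = Sum.inr w) (he' : G.nend l s e' = Sum.inr w)
    (hlt : sg s * G.slope l e < sg s * G.slope l e')
    (hsucc : ∀ a, G.nend l s a = Sum.inr w → sg s * G.slope l a < sg s * G.slope l e' →
      a = e ∨ sg s * G.slope l a < sg s * G.slope l e) :
    f (G.sideFace l false e') = f (G.sideFace l true e) := by
  have h1 := sum_jump_below hl f s he
  have h2 := sum_jump_below hl f s he'
  have hset : (Finset.univ.filter fun a => G.nend l s a = Sum.inr w ∧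
      sg s * G.slope l a < sg s * G.slope l e') =
      insert e (Finset.univ.filter fun a => G.nend l s a = Sum.inr w ∧
        sg s * G.slope l a < sg s * G.slope l e) := by
    ext a
    simp only [Finset.mem_filter, Finset.mem_univ, true_and, Finset.mem_insert]
    constructor
    · rintro ⟨ha, ha'⟩
      exact (hsucc a ha ha').imp id fun h => ⟨ha, h⟩
    · rintro (rfl | ⟨ha, ha'⟩)
      · exact ⟨he, hlt⟩
      · exact ⟨ha, ha'.trans hlt⟩
  rw [hset, Finset.sum_insert (by simp), h1, jump] at h2
  have : f (G.sideFace l true e) - f (G.vertexFace l false (Sum.inr w)) =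
      f (G.sideFace l false e') - f (G.vertexFace l false (Sum.inr w)) := by
    rw [← h2]; abel
  exact (sub_left_inj.1 this).symm

end

lemma exists_min_split {ι : Type*} {S : Finset ι} (g : ι → ℝ) (hg : Set.InjOn g S) {k : ℕ}
    (hk : S.card = k + 1) :
    ∃ a ∈ S, (S.erase a).card = k ∧ ∀ b ∈ S.erase a, g a < g b := by
  obtain ⟨a, ha, hmin⟩ := S.exists_min_image g (Finset.card_pos.1 (by omega))
  refine ⟨a, ha, by rw [Finset.card_erase_of_mem ha]; omega, fun b hb => ?_⟩
  rw [Finset.mem_erase] at hb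
  exact lt_of_le_of_ne (hmin b hb.2) fun h => hb.1 (hg ha hb.2 h).symm

/-- The half-edges on one side of an internal vertex. -/
def sideEdges (G : PlabicGraph n W E) (l : ℂ) (s : Bool) (w : W) : Finset E :=
  Finset.univ.filter fun e => G.nend l s e = Sum.inr w

lemma mem_sideEdges {s : Bool} {w : W} {e : E} :
    e ∈ G.sideEdges l s w ↔ G.nend l s e = Sum.inr w := by simp [sideEdges]

lemma injOn_slope (hl : G.IsGaugeDirection l) (s : Bool) (w : W) :
    Set.InjOn (fun e => sg s * G.slope l e) (G.sideEdges l s w) := by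
  intro a ha b hb h
  by_contra hne
  rw [Finset.mem_coe, mem_sideEdges] at ha hb
  exact slope_ne hl (ha.trans hb.symm) (Ne.symm hne) h

lemma faceInd_mul_of_ne {Ω A B : Set ℂ} (h : A ≠ B) : faceInd Ω A * faceInd Ω B = 0 := by
  unfold faceInd
  split_ifs with h1 h2
  · exact absurd (h1.trans h2.symm) h
  all_goals simp

lemma sideCorners (hG : G.IsPBDTP) (hl : G.IsGaugeDirection l) (Ω : Set ℂ) (s : Bool) (w : W)
    (hcard : (G.sideEdges l s w).card ≤ 3) :
    SideCorners (faceInd Ω (G.vertexFace l false (Sum.inr w)))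
      (faceInd Ω (G.vertexFace l true (Sum.inr w)))
      (∑ e ∈ G.sideEdges l s w, faceInd Ω (G.sideFace l false e))
      (∃ e ∈ G.sideEdges l s w, faceInd Ω (G.sideFace l false e) = 1)
      (G.sideEdges l s w).card := by
  have hinj := injOn_slope hl s w
  have hne : ∀ e, faceInd Ω (G.sideFace l false e) * faceInd Ω (G.sideFace l true e) = 0 :=
    fun e => faceInd_mul_of_ne (sideFace_ne hG hl e).symm
  set S := G.sideEdges l s w with hS
  have hmem : ∀ e, G.nend l s e = Sum.inr w ↔ e ∈ S := fun e => mem_sideEdges.symm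
  obtain hk | hk | hk | hk : S.card = 0 ∨ S.card = 1 ∨ S.card = 2 ∨ S.card = 3 := by omega
  · rw [hk]
    rw [Finset.card_eq_zero] at hk
    have h0 := sum_jump_side hl (faceInd Ω) s w
    rw [show (Finset.univ.filter fun e => G.nend l s e = Sum.inr w) = ∅ from hk,
      Finset.sum_empty] at h0
    refine .zero ?_ (sub_eq_zero.1 h0.symm) ?_ <;> simp [hk]
  · obtain ⟨a, ha⟩ := Finset.card_eq_one.1 hk
    rw [hk]
    simp only [ha, Finset.mem_singleton] at hmem
    have ha1 := (hmem a).2 rfl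
    have h1 := sideFace_false_of_min (faceInd Ω) hl ha1 (by simp [hmem])
    have h2 := sideFace_true_of_max (faceInd Ω) hl ha1 (by simp [hmem])
    have := hne a
    rw [h1, h2] at this
    refine .one ?_ this ?_ <;> simp [ha, h1]
  · obtain ⟨a, ha, hka, hmina⟩ := exists_min_split _ hinj (k := 1) hk
    obtain ⟨b, hb⟩ := Finset.card_eq_one.1 hka
    have hab : sg s * G.slope l a < sg s * G.slope l b := hmina b (by simp [hb])
    have hSe : S = {a, b} := by rw [← Finset.insert_erase ha, hb]
    have hab' : a ≠ b := by rintro rfl; exact lt_irrefl _ hab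
    rw [hk]
    simp only [hSe, Finset.mem_insert, Finset.mem_singleton] at hmem
    have ha1 := (hmem a).2 (Or.inl rfl)
    have hb1 := (hmem b).2 (Or.inr rfl)
    have h1 := sideFace_false_of_min (faceInd Ω) hl ha1 (by simp [hmem, hab.le])
    have h2 := sideFace_false_of_succ (faceInd Ω) hl ha1 hb1 hab (by simp [hmem])
    have h3 := sideFace_true_of_max (faceInd Ω) hl hb1 (by simp [hmem, hab.le])
    have e1 := hne a
    have e2 := hne b
    rw [h1] at e1
    rw [h3, h2] at e2
    refine .two (faceInd Ω (G.sideFace l true a)) ?_ e1 e2 ?_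
    · rw [hSe, Finset.sum_pair hab', h1, h2]
    · simp [hSe, h1, h2]
  · obtain ⟨a, ha, hka, hmina⟩ := exists_min_split _ hinj (k := 2) hk
    obtain ⟨b, hb, hkb, hminb⟩ := exists_min_split (fun e => sg s * G.slope l e)
      (hinj.mono (Finset.coe_subset.2 (Finset.erase_subset a S))) (k := 1) hka
    obtain ⟨c, hc⟩ := Finset.card_eq_one.1 hkb
    have hab : sg s * G.slope l a < sg s * G.slope l b := hmina b hb
    have hbc : sg s * G.slope l b < sg s * G.slope l c := hminb c (by simp [hc])
    have hac := hab.trans hbc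
    have hSe : S = {a, b, c} := by rw [← Finset.insert_erase ha, ← Finset.insert_erase hb, hc]
    have hab' : a ≠ b := by rintro rfl; exact lt_irrefl _ hab
    have hbc' : b ≠ c := by rintro rfl; exact lt_irrefl _ hbc
    have hac' : a ≠ c := by rintro rfl; exact lt_irrefl _ hac
    rw [hk]
    simp only [hSe, Finset.mem_insert, Finset.mem_singleton] at hmem
    have ha1 := (hmem a).2 (Or.inl rfl)
    have hb1 := (hmem b).2 (Or.inr (Or.inl rfl))
    have hc1 := (hmem c).2 (Or.inr (Or.inr rfl))
    have h1 := sideFace_false_of_min (faceInd Ω) hl ha1 (by simp [hmem, hab.le, hac.le])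
    have h2 := sideFace_false_of_succ (faceInd Ω) hl ha1 hb1 hab (by simp [hmem, hbc.le])
    have h3 := sideFace_false_of_succ (faceInd Ω) hl hb1 hc1 hbc (by simp [hmem, hab])
    have h4 := sideFace_true_of_max (faceInd Ω) hl hc1 (by simp [hmem, hbc.le, hac.le])
    have e1 := hne a
    have e2 := hne b
    have e3 := hne c
    rw [h1] at e1
    rw [h2] at e2
    rw [h3, h4] at e3
    refine .three (faceInd Ω (G.sideFace l true a)) (faceInd Ω (G.sideFace l true b)) ?_ e1 e2 e3 ?_
    · rw [hSe, Finset.sum_insert (by simp [hab', hac']), Finset.sum_pair hbc', h1, h2, h3]; ring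
    · simp [hSe, h1, h2, h3]

lemma card_sideEdges (hl : G.IsGaugeDirection l) (w : W) :
    (G.sideEdges l true w).card + (G.sideEdges l false w).card = 2 ∨
      (G.sideEdges l true w).card + (G.sideEdges l false w).card = 3 := by
  have hdisj : Disjoint (G.sideEdges l true w) (G.sideEdges l false w) := by
    rw [Finset.disjoint_left]
    intro e h1 h2
    rw [mem_sideEdges] at h1 h2
    have := nend_lt hl e
    rw [h1, h2] at this
    exact lt_irrefl _ this
  have hset : {e | G.src e = Sum.inr w ∨ G.tgt e = Sum.inr w} =
      ((G.sideEdges l true w ∪ G.sideEdges l false w : Finset E) : Set E) := by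
    ext e
    have := exists_nend_eq hl (e := e) (v := Sum.inr w)
    simp only [Bool.exists_bool] at this
    simp only [Set.mem_ofPred_eq, Finset.coe_union, Set.mem_union, Finset.mem_coe, mem_sideEdges]
    rw [or_comm (a := G.nend l true e = Sum.inr w), ← this, eq_comm, eq_comm (a := G.tgt e)]
  have := G.internal_degree w
  rw [hset, Set.ncard_coe_finset, Finset.card_union_of_disjoint hdisj] at this
  exact this

/-- The sum on the left counts, mod 2, the sectors at the vertex that belong to `Ω`: each sector is
counted once as lying below an edge, up to the sectors just above and just below the vertex. There
is at most one such sector. -/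
lemma sum_corners (hG : G.IsPBDTP) (hl : G.IsGaugeDirection l) {Ω : Set ℂ} (hΩ : G.IsFace Ω)
    (w : W) :
    ∑ e ∈ G.sideEdges l true w, faceInd Ω (G.sideFace l false e) +
      ∑ e ∈ G.sideEdges l false w, faceInd Ω (G.sideFace l false e) +
      faceInd Ω (G.vertexFace l true (Sum.inr w)) + faceInd Ω (G.vertexFace l false (Sum.inr w)) =
      if G.pos (Sum.inr w) ∈ frontier Ω then 1 else 0 := by
  have hcard := card_sideEdges hl w
  refine SideCorners.add_eq _ _ _ _ _ (sideCorners hG hl Ω true w (by omega))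
    (sideCorners hG hl Ω false w (by omega)) hcard ?_
  rw [mem_frontier_iff hl hΩ]
  simp only [Bool.exists_bool, mem_sideEdges, faceInd_eq_one]
  split_ifs with h <;> simpa using h

/-! ### The contributions of the vertices -/

lemma sum_ends (hl : G.IsGaugeDirection l) {A : Type*} [AddCommMonoid A] (g : E → A)
    (v : Fin n ⊕ W) :
    ∑ e with G.nend l true e = v, g e + ∑ e with G.nend l false e = v, g e =
      ∑ e with G.src e = v, g e + ∑ e with G.tgt e = v, g e := by
  simp only [Finset.sum_filter, ← Finset.sum_add_distrib]
  refine Finset.sum_congr rfl fun e _ => ?_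
  rcases nend_cases hl e with ⟨-, h1, h2⟩ | ⟨-, h1, h2⟩ <;> rw [h1, h2]
  rw [add_comm]

lemma exists_unique_in (w : W) (hw : G.colour w = .white) :
    ∃ a, ∀ e, G.tgt e = Sum.inr w ↔ e = a := by
  obtain ⟨a, ha⟩ := Set.ncard_eq_one.1 (G.white_perfect w hw)
  exact ⟨a, fun e => by simpa using Set.ext_iff.1 ha e⟩

lemma exists_unique_out (w : W) (hw : G.colour w = .black) :
    ∃ a, ∀ e, G.src e = Sum.inr w ↔ e = a := by
  obtain ⟨a, ha⟩ := Set.ncard_eq_one.1 (G.black_perfect w hw)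
  exact ⟨a, fun e => by simpa using Set.ext_iff.1 ha e⟩

lemma nend_unique (hl : G.IsGaugeDirection l) {e : E} {s s' : Bool} {v : Fin n ⊕ W}
    (h : G.nend l s e = v) (h' : G.nend l s' e = v) : s = s' := by
  by_contra hne
  obtain rfl : s' = !s := by cases s <;> cases s' <;> simp_all
  have := nend_not hl s e
  rw [h, h'] at this
  simp at this

/-- The contribution `α` of the initial vertex of an edge to its signature, mod 2. -/
def srcIndex (G : PlabicGraph n W E) (l : ℂ) (e : E) : ZMod 2 :=
  match G.src e with
  | Sum.inl _ => 1
  | Sum.inr U => if G.colour U = .white then 1 + (G.windIn l e : ZMod 2) else 0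

/-- The contribution `β` of the final vertex of an edge to its signature, mod 2. -/
def tgtIndex (G : PlabicGraph n W E) (l : ℂ) (e : E) : ZMod 2 :=
  match G.tgt e with
  | Sum.inl _ => 0
  | Sum.inr V => if G.colour V = .black then (G.windOut l e : ZMod 2) else 0

lemma not_boundary_boundary (e : E) (i j : Fin n) :
    ¬ (G.src e = Sum.inl i ∧ G.tgt e = Sum.inl j) := by
  rintro ⟨h1, h2⟩
  have := G.edge_inside e ((1 / 2 : ℝ) • G.pos (G.src e) + (1 / 2 : ℝ) • G.pos (G.tgt e))
    ⟨1 / 2, 1 / 2, by norm_num, by norm_num, by norm_num, rfl⟩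
  simp [h1, h2, G.boundary_im] at this

lemma geomIndex_cast (e : E) : (G.geomIndex l e : ZMod 2) =
    (G.intNumber l e : ZMod 2) + G.srcIndex l e + G.tgtIndex l e := by
  have hb := not_boundary_boundary (G := G) e
  unfold geomIndex srcIndex tgtIndex
  rcases hs : G.src e with i | U <;> rcases ht : G.tgt e with j | V
  · exact absurd ⟨hs, ht⟩ (hb i j)
  · cases hV : G.colour V <;> (simp [hV]; ring)
  · cases hU : G.colour U
    · simp [hU]; ring
    · simp [hU]
  · cases hU : G.colour U <;> cases hV : G.colour V <;> simp [hU, hV] <;> ring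

lemma zmod_two_sub (a b : ZMod 2) : a - b = a + b := by revert a b; decide

/-- The winding terms at a white vertex involve the outgoing edges that lie above the incoming edge on
its side; their jumps lead from the face above the incoming edge to the face above the vertex. -/
lemma sum_srcIndex_white (hG : G.IsPBDTP) (hl : G.IsGaugeDirection l) {Ω : Set ℂ}
    (hΩ : G.IsFace Ω) (w : W) (hw : G.colour w = .white) :
    ∑ e with G.src e = Sum.inr w, G.jump l (faceInd Ω) e * G.srcIndex l e =
      (if G.pos (Sum.inr w) ∈ frontier Ω then 1 else 0) +
        ∑ e with G.src e = Sum.inr w, faceInd Ω (G.sideFace l false e) +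
        faceInd Ω (G.vertexFace l false (Sum.inr w)) := by
  obtain ⟨a, ha⟩ := exists_unique_in w hw
  have hat : G.tgt a = Sum.inr w := (ha a).2 rfl
  obtain ⟨s, hs⟩ := (exists_nend_eq hl (e := a)).1 (Or.inr hat.symm)
  have htgt : (Finset.univ.filter fun e => G.tgt e = Sum.inr w) = {a} := by
    ext e; simp [ha]
  have hwind : ∑ e with G.src e = Sum.inr w, G.jump l (faceInd Ω) e * (G.windIn l e : ZMod 2) =
      faceInd Ω (G.vertexFace l true (Sum.inr w)) - faceInd Ω (G.sideFace l true a) := by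
    rw [← sum_jump_above hl (faceInd Ω) s hs, Finset.sum_filter, Finset.sum_filter]
    refine Finset.sum_congr rfl fun e _ => ?_
    by_cases he : G.src e = Sum.inr w
    · rw [if_pos he, windIn, he, htgt, Finset.sum_singleton,
        localWind_cast hl (hat.trans he.symm), he]
      have hiff : (∃ s, G.nend l s a = Sum.inr w ∧ G.nend l s e = Sum.inr w ∧
          sg s * G.slope l a < sg s * G.slope l e) ↔
          G.nend l s e = Sum.inr w ∧ sg s * G.slope l a < sg s * G.slope l e := by
        constructor
        · rintro ⟨s', h1, h2⟩
          obtain rfl := nend_unique hl h1 hs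
          exact h2
        · rintro ⟨h1, h2⟩
          exact ⟨s, hs, h1, h2⟩
      simp only [hiff]
      split_ifs <;> simp
    · rw [if_neg he, if_neg]
      rintro ⟨h1, h2⟩
      rcases nend_eq_or (G := G) (l := l) s e with h | h
      · exact he (h.symm.trans h1)
      · rw [(ha e).1 (h.symm.trans h1)] at h2
        exact lt_irrefl _ h2
  have hsum := sum_ends hl (G.jump l (faceInd Ω)) (Sum.inr w)
  rw [sum_jump_side hl, sum_jump_side hl, htgt, Finset.sum_singleton, jump] at hsum
  have hb := sum_ends hl (fun e => faceInd Ω (G.sideFace l false e)) (Sum.inr w)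
  rw [htgt, Finset.sum_singleton] at hb
  have hcor := sum_corners hG hl hΩ w
  rw [sideEdges, sideEdges, hb] at hcor
  have hL : ∑ e with G.src e = Sum.inr w, G.jump l (faceInd Ω) e * G.srcIndex l e =
      ∑ e with G.src e = Sum.inr w, G.jump l (faceInd Ω) e +
        ∑ e with G.src e = Sum.inr w, G.jump l (faceInd Ω) e * (G.windIn l e : ZMod 2) := by
    rw [← Finset.sum_add_distrib]
    refine Finset.sum_congr rfl fun e he => ?_
    rw [srcIndex, (Finset.mem_filter.1 he).2]
    simp only [hw, if_true]
    ring
  rw [hL, hwind, ← hcor]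
  -- what remains follows formally from `hsum`, mod 2
  generalize ∑ e with G.src e = Sum.inr w, G.jump l (faceInd Ω) e = x1 at *
  generalize ∑ e with G.src e = Sum.inr w, faceInd Ω (G.sideFace l false e) = x2 at *
  generalize faceInd Ω (G.vertexFace l true (Sum.inr w)) = x3 at *
  generalize faceInd Ω (G.vertexFace l false (Sum.inr w)) = x4 at *
  generalize faceInd Ω (G.sideFace l true a) = x5 at *
  generalize faceInd Ω (G.sideFace l false a) = x6 at *
  clear hL hwind hcor hb
  revert x1 x2 x3 x4 x5 x6
  decide

/-- The winding terms at a black vertex involve the incoming edges that lie below the outgoing edge on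
its side; their jumps lead from the face below the vertex to the face below the outgoing edge. -/
lemma sum_tgtIndex_black (hl : G.IsGaugeDirection l) (Ω : Set ℂ)
    (w : W) (hw : G.colour w = .black) :
    ∑ e with G.tgt e = Sum.inr w, G.jump l (faceInd Ω) e * G.tgtIndex l e =
      ∑ e with G.src e = Sum.inr w, faceInd Ω (G.sideFace l false e) +
        faceInd Ω (G.vertexFace l false (Sum.inr w)) := by
  obtain ⟨b, hb⟩ := exists_unique_out w hw
  have hbs : G.src b = Sum.inr w := (hb b).2 rfl
  obtain ⟨s, hs⟩ := (exists_nend_eq hl (e := b)).1 (Or.inl hbs.symm)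
  have hsrc : (Finset.univ.filter fun e => G.src e = Sum.inr w) = {b} := by
    ext e; simp [hb]
  rw [hsrc, Finset.sum_singleton, ← zmod_two_sub, ← sum_jump_below hl (faceInd Ω) s hs,
    Finset.sum_filter, Finset.sum_filter]
  refine Finset.sum_congr rfl fun e _ => ?_
  by_cases he : G.tgt e = Sum.inr w
  · rw [if_pos he, tgtIndex, he]
    simp only [hw, if_true]
    rw [windOut, he, hsrc, Finset.sum_singleton, localWind_cast hl (he.trans hbs.symm), hbs]
    have hiff : (∃ s, G.nend l s e = Sum.inr w ∧ G.nend l s b = Sum.inr w ∧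
        sg s * G.slope l e < sg s * G.slope l b) ↔
        G.nend l s e = Sum.inr w ∧ sg s * G.slope l e < sg s * G.slope l b := by
      constructor
      · rintro ⟨s', h1, h2, h3⟩
        obtain rfl := nend_unique hl h2 hs
        exact ⟨h1, h3⟩
      · rintro ⟨h1, h2⟩
        exact ⟨s, h1, hs, h2⟩
    simp only [hiff]
    split_ifs <;> simp
  · rw [if_neg he, if_neg]
    rintro ⟨h1, h2⟩
    rcases nend_eq_or (G := G) (l := l) s e with h | h
    · rw [(hb e).1 (h.symm.trans h1)] at h2
      exact lt_irrefl _ h2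
    · exact he (h.symm.trans h1)

/-- The contribution of an internal vertex to the total signature of a face. -/
lemma sum_index_internal (hG : G.IsPBDTP) (hl : G.IsGaugeDirection l) {Ω : Set ℂ}
    (hΩ : G.IsFace Ω) (w : W) :
    ∑ e with G.src e = Sum.inr w, G.jump l (faceInd Ω) e * G.srcIndex l e +
      ∑ e with G.tgt e = Sum.inr w, G.jump l (faceInd Ω) e * G.tgtIndex l e =
      (if G.colour w = .white ∧ G.pos (Sum.inr w) ∈ frontier Ω then 1 else 0) +
        ∑ e with G.src e = Sum.inr w, faceInd Ω (G.sideFace l false e) +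
        faceInd Ω (G.vertexFace l false (Sum.inr w)) := by
  cases hw : G.colour w
  · have h0 : ∑ e with G.tgt e = Sum.inr w, G.jump l (faceInd Ω) e * G.tgtIndex l e = 0 := by
      refine Finset.sum_eq_zero fun e he => ?_
      rw [tgtIndex, (Finset.mem_filter.1 he).2]
      simp [hw]
    rw [h0, add_zero, sum_srcIndex_white hG hl hΩ w hw]
    simp
  · have h0 : ∑ e with G.src e = Sum.inr w, G.jump l (faceInd Ω) e * G.srcIndex l e = 0 := by
      refine Finset.sum_eq_zero fun e he => ?_
      rw [srcIndex, (Finset.mem_filter.1 he).2]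
      simp [hw]
    rw [h0, zero_add, sum_tgtIndex_black hl Ω w hw]
    simp

/-- The contribution of a boundary vertex to the total signature of a face. -/
lemma sum_index_boundary (hl : G.IsGaugeDirection l) (Ω : Set ℂ) (i : Fin n) :
    ∑ e with G.src e = Sum.inl i, G.jump l (faceInd Ω) e * G.srcIndex l e =
      (if G.IsSource i then faceInd Ω (G.vertexFace l true (Sum.inl i)) else 0) +
        ∑ e with G.src e = Sum.inl i, faceInd Ω (G.sideFace l false e) := by
  by_cases h : G.IsSource i
  · obtain ⟨a, ha⟩ := h
    obtain ⟨e₀, -, huniq⟩ := G.boundary_degree i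
    have hset : (Finset.univ.filter fun e => G.src e = Sum.inl i) = {a} := by
      ext e
      simp only [Finset.mem_filter, Finset.mem_univ, true_and, Finset.mem_singleton]
      constructor
      · intro he
        rw [huniq e (Or.inl he), huniq a (Or.inl ha)]
      · rintro rfl; exact ha
    obtain ⟨s, hs⟩ := (exists_nend_eq hl (e := a)).1 (Or.inl ha.symm)
    have hup := sideFace_true_of_max (faceInd Ω) hl hs (by
      intro e' he'
      have : e' = a := by
        have h1 := huniq e' (by
          rcases nend_eq_or (G := G) (l := l) s e' with h | h <;> rw [h] at he'
          · exact Or.inl he'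
          · exact Or.inr he')
        rw [h1, huniq a (Or.inl ha)]
      rw [this]
      exact lt_irrefl _)
    rw [hset, Finset.sum_singleton, Finset.sum_singleton, if_pos ⟨a, ha⟩, ← hup, jump, srcIndex, ha,
      mul_one, zmod_two_sub]
  · have hset : (Finset.univ.filter fun e => G.src e = Sum.inl i) = ∅ :=
      Finset.filter_false_of_mem fun e _ he => h ⟨e, he⟩
    rw [hset, if_neg h]
    simp

/-- The gauge rays from the sources, counted on the boundary of a face. -/
lemma sum_jump_mul_intNumber (hl : G.IsGaugeDirection l) (Ω : Set ℂ) :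
    ∑ e, G.jump l (faceInd Ω) e * (G.intNumber l e : ZMod 2) =
      (G.numSources : ZMod 2) * faceInd Ω (G.topFace l) +
        ∑ i, if G.IsSource i then faceInd Ω (G.vertexFace l true (Sum.inl i)) else 0 := by
  simp only [intNumber_cast hl, Finset.mul_sum]
  rw [Finset.sum_comm]
  have h1 : ∀ i, ∑ e, G.jump l (faceInd Ω) e *
      (if G.Spans l e (G.vx l (Sum.inl i)) then (1 : ZMod 2) else 0) =
      faceInd Ω (G.topFace l) + faceInd Ω (G.vertexFace l true (Sum.inl i)) := by
    intro i
    rw [← zmod_two_sub, ← sum_jump_ray hl, Finset.sum_filter]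
    simp
  rw [Finset.sum_congr rfl fun i _ => h1 i, Finset.sum_add_distrib, Finset.sum_const,
    nsmul_eq_mul, ← Finset.sum_filter]
  congr 3
  rw [numSources, Set.ncard_eq_toFinset_card']
  congr 1
  ext; simp

/-- A gauge transformation does not change the total signature of a face. -/
lemma sum_jump_mul_gauge (hl : G.IsGaugeDirection l) (f : Set ℂ → ZMod 2) (η : W → ZMod 2) :
    ∑ e, G.jump l f e * (extendVertex η (G.src e) + extendVertex η (G.tgt e)) = 0 := by
  have h1 : ∀ e, extendVertex η (G.src e) + extendVertex η (G.tgt e) =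
      extendVertex η (G.nend l true e) + extendVertex η (G.nend l false e) := by
    intro e
    rcases nend_cases hl e with ⟨-, h1, h2⟩ | ⟨-, h1, h2⟩ <;> rw [h1, h2]
    rw [add_comm]
  simp only [h1, mul_add, Finset.sum_add_distrib]
  rw [sum_jump_mul_end hl, sum_jump_mul_end hl, CharTwo.add_self_eq_zero]

lemma nWhite_cast (Ω : Set ℂ) : (G.nWhite Ω : ZMod 2) =
    ∑ w, if G.colour w = .white ∧ G.pos (Sum.inr w) ∈ frontier Ω then (1 : ZMod 2) else 0 := by
  rw [nWhite, Set.ncard_eq_toFinset_card', Finset.sum_boole]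
  congr 2
  ext; simp

/-- Euler's formula for a face, mod 2. -/
lemma sum_faceInd_below (hl : G.IsGaugeDirection l) {Ω : Set ℂ} (hΩ : G.IsFace Ω) :
    faceInd Ω (G.topFace l) + ∑ e, faceInd Ω (G.sideFace l false e) =
      ∑ w, faceInd Ω (G.vertexFace l false (Sum.inr w)) + 1 := by
  have h := congrArg (Nat.cast : ℕ → ZMod 2) (card_belowFace_eq hl hΩ)
  rw [Nat.cast_add, Nat.cast_one, ← Finset.sum_boole, ← Finset.sum_boole,
    Fintype.sum_option] at h
  exact h

/-- The total signature of a face, finite or infinite: the contributions of the edges are distributed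
to the vertices, and what remains is evaluated by Euler's formula for the face. -/
lemma faceSignature_geometric (hG : G.IsPBDTP) (hl : G.IsGaugeDirection l) {ε : E → ZMod 2}
    (hε : G.IsGeometricSignature l ε) {Ω : Set ℂ} (hΩ : G.IsFace Ω) :
    G.faceSignature ε Ω = (G.nWhite Ω : ZMod 2) +
      (G.numSources : ZMod 2) * faceInd Ω (G.topFace l) + faceInd Ω (G.topFace l) + 1 := by
  obtain ⟨η, hη⟩ := hε
  have hsplit : ∑ e, G.jump l (faceInd Ω) e * ε e =
      ∑ e, G.jump l (faceInd Ω) e * (G.intNumber l e : ZMod 2) +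
        (∑ e, G.jump l (faceInd Ω) e * G.srcIndex l e +
          ∑ e, G.jump l (faceInd Ω) e * G.tgtIndex l e) := by
    rw [← add_zero (∑ e, G.jump l (faceInd Ω) e * (G.intNumber l e : ZMod 2) + _),
      ← sum_jump_mul_gauge hl (faceInd Ω) η]
    simp only [← Finset.sum_add_distrib]
    refine Finset.sum_congr rfl fun e _ => ?_
    rw [hη e]
    simp only [geomIndex_cast, extendVertex]
    ring
  have hlocal : ∑ e, G.jump l (faceInd Ω) e * G.srcIndex l e +
      ∑ e, G.jump l (faceInd Ω) e * G.tgtIndex l e =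
      (∑ i, if G.IsSource i then faceInd Ω (G.vertexFace l true (Sum.inl i)) else 0) +
        G.nWhite Ω + ∑ e, faceInd Ω (G.sideFace l false e) +
        ∑ w, faceInd Ω (G.vertexFace l false (Sum.inr w)) := by
    have hb0 : ∀ i : Fin n, ∑ e with G.tgt e = Sum.inl i,
        G.jump l (faceInd Ω) e * G.tgtIndex l e = 0 := by
      intro i
      refine Finset.sum_eq_zero fun e he => ?_
      rw [tgtIndex, (Finset.mem_filter.1 he).2]
      simp
    rw [← Finset.sum_fiberwise Finset.univ G.src (fun e => _ * G.srcIndex l e),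
      ← Finset.sum_fiberwise Finset.univ G.tgt (fun e => _ * G.tgtIndex l e),
      ← Finset.sum_fiberwise Finset.univ G.src (fun e => faceInd Ω (G.sideFace l false e)),
      Fintype.sum_sum_type, Fintype.sum_sum_type, Fintype.sum_sum_type,
      Finset.sum_eq_zero fun i _ => hb0 i, zero_add, add_assoc, ← Finset.sum_add_distrib,
      Finset.sum_congr rfl fun w _ => sum_index_internal hG hl hΩ w,
      Finset.sum_congr rfl fun i _ => sum_index_boundary hl Ω i, nWhite_cast]
    simp only [Finset.sum_add_distrib]
    ring
  have heul := sum_faceInd_below hl hΩ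
  rw [faceSignature_eq hG hl hΩ, hsplit, hlocal, sum_jump_mul_intNumber hl]
  clear hsplit hlocal
  -- what remains follows formally from `heul`, mod 2
  generalize (∑ i, if G.IsSource i then faceInd Ω (G.vertexFace l true (Sum.inl i)) else 0) = x1
  generalize ∑ e, faceInd Ω (G.sideFace l false e) = x2 at *
  generalize ∑ w, faceInd Ω (G.vertexFace l false (Sum.inr w)) = x3 at *
  generalize faceInd Ω (G.topFace l) = x4 at *
  generalize (G.nWhite Ω : ZMod 2) = x5
  generalize (G.numSources : ZMod 2) = x6
  revert x1 x2 x3 x4 x5 x6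
  decide

end

end PlabicGraph

end

theorem mainTheorem4 {n : ℕ} {W E : Type*} [Fintype W] [Fintype E] (G : PlabicGraph n W E)
    (hG : G.IsPBDTP) (l : ℂ) (hl : G.IsGaugeDirection l)
    (ε : E → ZMod 2) (hε : G.IsGeometricSignature l ε) (Ω : Set ℂ) :
    (G.IsFiniteFace Ω → G.faceSignature ε Ω = (G.nWhite Ω : ZMod 2) + 1) ∧
      (G.IsInfiniteFace Ω → G.faceSignature ε Ω = (G.nWhite Ω : ZMod 2) + (G.numSources : ZMod 2)) := by
  constructor
  · rintro ⟨hΩ, hb⟩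
    have htop : PlabicGraph.faceInd Ω (G.topFace l) = 0 := by
      rw [PlabicGraph.faceInd, if_neg]
      rintro rfl
      exact PlabicGraph.not_isBounded_topFace hb
    rw [PlabicGraph.faceSignature_geometric hG hl hε hΩ, htop]
    ring
  · rintro ⟨hΩ, hb⟩
    have htop : PlabicGraph.faceInd Ω (G.topFace l) = 1 :=
      PlabicGraph.faceInd_eq_one.2 (hΩ.eq_topFace_of_not_isBounded hl hb).symm
    rw [PlabicGraph.faceSignature_geometric hG hl hε hΩ, htop, mul_one, add_assoc,
      CharTwo.add_self_eq_zero, add_zero]
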